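/- **Conventions.** Let $N$ be a smooth manifold. An almost contact metric structure on $N$ is a tuple $(g,\xi,\eta,\varphi)$ consisting of a Riemannian metric $g$, a vector field $\xi$ with $g(\xi,\xi)=1$ (the Reeb field), its dual $1$-form $\eta=g(\xi,\cdot)$, and a bundle endomorphism $\varphi$ of $TN$, all smooth, such that $\varphi(\xi)=0$, $\varphi^2=-1+\eta\otimes\xi$ and $g(\varphi X,\varphi Y)=g(X,Y)-\eta(X)\eta(Y)$. It is normal if $$[\varphi X,\varphi Y]+\varphi^2[X,Y]-\varphi[\varphi X,Y]-\varphi[X,\varphi Y]+d\eta(X,Y)\,\xi=0$$ for all vector fields $X,Y$, where $d\eta(X,Y)=X(\eta(Y))-Y(\eta(X))-\eta([X,Y])$. Put $F=g(\varphi\,\cdot,\cdot)$ and $$c=\eta\wedge d\eta+dF(\varphi\,\cdot,\varphi\,\cdot,\varphi\,\cdot).$$ An ST structure is a normal almost contact metric structure for which $\xi$ is a Killing field, and it is an SST structure if moreover $dc=0$. An ST connection of $(g,\xi,\eta,\varphi)$ is a connection $\nabla$ on $TN$ with $\nabla g=0$, $\nabla\xi=0$, $\nabla\varphi=0$ such that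 $(X,Y,Z)\mapsto g(\nabla_XY-\nabla_YX-[X,Y],Z)$ is a $3$-form (its torsion form). On a Lie group, the structure is left-invariant if all left translations preserve $g$, $\xi$ and $\varphi$ (and hence $\eta$). **Theorem.** Every odd-dimensional connected compact Lie group $G$, with Lie algebra $\mathfrak g$, admits a left-invariant SST structure $(g,\xi,\eta,\varphi)$. Moreover, it can be chosen such that all of the following hold. 1. The metric $g$ is bi-invariant. 2. There are a Cartan subalgebra $\mathfrak t$ of $\mathfrak g$ with $\xi_e\in\mathfrak t$ and $\varphi_e(\mathfrak t)\subseteq\mathfrak t$, and a set of positive roots of $\mathfrak g\otimes\mathbb C$ with respect to $\mathfrak t\otimes\mathbb C$ (of each root and its negative exactly one is positive, and a root that is a sum of two positive roots is positive), such that the complex linear extension of $\varphi_e$ is multiplication by $i$ on each root space $\mathfrak g_\alpha$ with $\alpha$ positive and by $-i$ on each $\mathfrak g_{-\alpha}$ with $\alpha$ positive. 3. $c(X,Y,Z)=-g([X,Y],Z)$ for all left-invariant vector fields $X,Y,Z$. 4. The canonical connection $\nabla$ of $G$, for which all left-invariant vector fields are parallel, is flat; it is the unique ST connection of $(g,\xi,\eta,\varphi)$,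 and its torsion form is $c$. -/

import Mathlib

open Bundle VectorField
open scoped Manifold ContDiff TensorProduct

noncomputable section

namespace SasakiTorsion

/-! ### Calculus with smooth vector fields

Differential forms are used through their values on smooth vector fields: a `k`-form is an
alternating map, linear over the smooth functions, from `k`-tuples of smooth vector fields to
functions, and its exterior derivative is given by the invariant formula (no factor `1 / (k + 1)`).
-/

section Manifold

variable {E : Type*} [NormedAddCommGroup E] [NormedSpace ℝ E]
  {H : Type*} [TopologicalSpace H] (I : ModelWithCorners ℝ E H)
  {M : Type*} [TopologicalSpace M] [ChartedSpace H M]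

/-- The vector field `X` is smooth. -/
def IsSmoothField [IsManifold I ∞ M] (X : Π x : M, TangentSpace I x) : Prop :=
  ContMDiff I I.tangent ∞ (fun x ↦ (⟨x, X x⟩ : TangentBundle I M))

/-- The derivative `X(f)` of a function along a vector field. -/
def lieDerivFun (X : Π x : M, TangentSpace I x) (f : M → ℝ) (x : M) : ℝ :=
  mvfderiv I f x (X x)

/-- The exterior derivative of a `1`-form:
`dα(X, Y) = X(α(Y)) - Y(α(X)) - α([X, Y])`. -/
def extDerivOne (α : (Π x : M, TangentSpace I x) → M → ℝ)
    (X Y : Π x : M, TangentSpace I x) (x : M) : ℝ :=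
  lieDerivFun I X (α Y) x - lieDerivFun I Y (α X) x - α (mlieBracket I X Y) x

/-- The exterior derivative of a `2`-form. -/
def extDerivTwo (omega : (Π x : M, TangentSpace I x) → (Π x : M, TangentSpace I x) → M → ℝ)
    (X Y Z : Π x : M, TangentSpace I x) (x : M) : ℝ :=
  lieDerivFun I X (omega Y Z) x - lieDerivFun I Y (omega X Z) x + lieDerivFun I Z (omega X Y) x
    - omega (mlieBracket I X Y) Z x + omega (mlieBracket I X Z) Y x - omega (mlieBracket I Y Z) X x

/-- The exterior derivative of a `3`-form. -/
def extDerivThree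
    (omega : (Π x : M, TangentSpace I x) → (Π x : M, TangentSpace I x) →
      (Π x : M, TangentSpace I x) → M → ℝ)
    (X Y Z W : Π x : M, TangentSpace I x) (x : M) : ℝ :=
  lieDerivFun I X (omega Y Z W) x - lieDerivFun I Y (omega X Z W) x
    + lieDerivFun I Z (omega X Y W) x - lieDerivFun I W (omega X Y Z) x
    - omega (mlieBracket I X Y) Z W x + omega (mlieBracket I X Z) Y W x
    - omega (mlieBracket I X W) Y Z x - omega (mlieBracket I Y Z) X W x
    + omega (mlieBracket I Y W) X Z x - omega (mlieBracket I Z W) X Y x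

variable (M) in
/-- An almost contact metric structure `(g, ξ, η, φ)` on a manifold, the `1`-form `η` being the
metric dual of `ξ`: it is `AlmostContactMetric.eta` below. -/
structure AlmostContactMetric [IsManifold I ∞ M] where
  /-- The Riemannian metric. -/
  g : ContMDiffRiemannianMetric I ∞ E (fun x : M ↦ TangentSpace I x)
  /-- The Reeb vector field. -/
  xi : Π x : M, TangentSpace I x
  smooth_xi : IsSmoothField I xi
  /-- The bundle endomorphism. -/
  phi : Π x : M, TangentSpace I x →L[ℝ] TangentSpace I x
  smooth_phi : ContMDiff I (I.prod 𝓘(ℝ, E →L[ℝ] E)) ∞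
    (fun x ↦ TotalSpace.mk' (E →L[ℝ] E)
      (E := fun y : M ↦ TangentSpace I y →L[ℝ] TangentSpace I y) x (phi x))
  unit_xi : ∀ x, g.inner x (xi x) (xi x) = 1
  phi_xi : ∀ x, phi x (xi x) = 0
  phi_phi : ∀ x (v : TangentSpace I x), phi x (phi x v) = -v + g.inner x (xi x) v • xi x
  inner_phi_phi : ∀ x (v w : TangentSpace I x), g.inner x (phi x v) (phi x w) =
    g.inner x v w - g.inner x (xi x) v * g.inner x (xi x) w

namespace AlmostContactMetric

variable {I} [IsManifold I ∞ M] (S : AlmostContactMetric I M)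

/-- The function `g(X, Y)`. -/
def metric (X Y : Π x : M, TangentSpace I x) (x : M) : ℝ := S.g.inner x (X x) (Y x)

/-- The `1`-form `η = g(ξ, ·)`. -/
def eta (X : Π x : M, TangentSpace I x) (x : M) : ℝ := S.g.inner x (S.xi x) (X x)

/-- The vector field `φ(X)`. -/
def phiField (X : Π x : M, TangentSpace I x) (x : M) : TangentSpace I x := S.phi x (X x)

/-- The fundamental `2`-form `F = g(φ ·, ·)`. -/
def fundForm (X Y : Π x : M, TangentSpace I x) (x : M) : ℝ := S.g.inner x (S.phi x (X x)) (Y x)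

/-- Normality: the Sasaki-Hatakeyama tensor
`[φX, φY] + φ²[X, Y] - φ[φX, Y] - φ[X, φY] + dη(X, Y) ξ` vanishes. -/
def IsNormal : Prop :=
  ∀ X Y : Π x : M, TangentSpace I x, IsSmoothField I X → IsSmoothField I Y → ∀ x : M,
    mlieBracket I (S.phiField X) (S.phiField Y) x + S.phi x (S.phi x (mlieBracket I X Y x))
      - S.phi x (mlieBracket I (S.phiField X) Y x) - S.phi x (mlieBracket I X (S.phiField Y) x)
      + extDerivOne I S.eta X Y x • S.xi x = 0

/-- The Reeb field is Killing: `(L_ξ g)(X, Y) = ξ(g(X, Y)) - g([ξ, X], Y) - g(X, [ξ, Y])`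
vanishes. -/
def IsKilling : Prop :=
  ∀ X Y : Π x : M, TangentSpace I x, IsSmoothField I X → IsSmoothField I Y → ∀ x : M,
    lieDerivFun I S.xi (S.metric X Y) x - S.metric (mlieBracket I S.xi X) Y x
      - S.metric X (mlieBracket I S.xi Y) x = 0

/-- The `3`-form `c = η ∧ dη + dF(φ ·, φ ·, φ ·)`. -/
def torsionForm (X Y Z : Π x : M, TangentSpace I x) (x : M) : ℝ :=
  S.eta X x * extDerivOne I S.eta Y Z x + S.eta Y x * extDerivOne I S.eta Z X x
    + S.eta Z x * extDerivOne I S.eta X Y x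
    + extDerivTwo I S.fundForm (S.phiField X) (S.phiField Y) (S.phiField Z) x

/-- A Sasaki with torsion structure: normal with Killing Reeb field. -/
structure IsST : Prop where
  normal : S.IsNormal
  killing : S.IsKilling

/-- A strong Sasaki with torsion structure: moreover the torsion `3`-form is closed. -/
structure IsSST : Prop extends S.IsST where
  closed : ∀ X Y Z W : Π x : M, TangentSpace I x, IsSmoothField I X → IsSmoothField I Y →
    IsSmoothField I Z → IsSmoothField I W → ∀ x : M, extDerivThree I S.torsionForm X Y Z W x = 0

/-- `∇` is an almost contact metric connection, i.e. `∇g = 0`, `∇ξ = 0`, `∇φ = 0`, whose torsion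
`(X, Y, Z) ↦ g(∇_X Y - ∇_Y X - [X, Y], Z)` is totally skew. In Mathlib's notation
`∇_X Y` at `x` is `nabla Y x (X x)`. -/
structure IsSTConnection
    (nabla : CovariantDerivative I E (fun x : M ↦ TangentSpace I x)) : Prop where
  smooth : ∀ X Y : Π x : M, TangentSpace I x, IsSmoothField I X → IsSmoothField I Y →
    IsSmoothField I (fun x ↦ nabla Y x (X x))
  metric : ∀ X Y Z : Π x : M, TangentSpace I x, IsSmoothField I X → IsSmoothField I Y →
    IsSmoothField I Z → ∀ x : M, lieDerivFun I X (S.metric Y Z) x =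
      S.g.inner x (nabla Y x (X x)) (Z x) + S.g.inner x (Y x) (nabla Z x (X x))
  reeb : ∀ x : M, nabla S.xi x = 0
  phi : ∀ X Y : Π x : M, TangentSpace I x, IsSmoothField I X → IsSmoothField I Y →
    ∀ x : M, nabla (S.phiField Y) x (X x) = S.phi x (nabla Y x (X x))
  skew : ∀ X Y Z : Π x : M, TangentSpace I x, IsSmoothField I X → IsSmoothField I Y →
    IsSmoothField I Z → ∀ x : M,
      S.g.inner x (nabla Y x (X x) - nabla X x (Y x) - mlieBracket I X Y x) (Z x) =
        -S.g.inner x (nabla Z x (X x) - nabla X x (Z x) - mlieBracket I X Z x) (Y x)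

end AlmostContactMetric

end Manifold

/-! ### Left-invariance on a Lie group -/

section Group

variable {E : Type*} [NormedAddCommGroup E] [NormedSpace ℝ E]
  {H : Type*} [TopologicalSpace H] {I : ModelWithCorners ℝ E H}
  {G : Type*} [TopologicalSpace G] [ChartedSpace H G] [Group G] [LieGroup I ∞ G]

instance instLieGroupMinSmoothness : LieGroup I (minSmoothness ℝ 3) G :=
  LieGroup.of_le (n := ∞) (by rw [minSmoothness_of_isRCLikeNormedField]; exact ENat.LEInfty.out)

/-- All left translations preserve `g`, `ξ` and `φ` (hence `η = g(ξ, ·)`). -/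
structure IsLeftInvariant (S : AlmostContactMetric I G) : Prop where
  metric : ∀ (a x : G) (v w : TangentSpace I x),
    S.g.inner (a * x) (mfderiv I I (fun y ↦ a * y) x v) (mfderiv I I (fun y ↦ a * y) x w) =
      S.g.inner x v w
  reeb : ∀ a x : G, mfderiv I I (fun y ↦ a * y) x (S.xi x) = S.xi (a * x)
  phi : ∀ (a x : G) (v : TangentSpace I x),
    mfderiv I I (fun y ↦ a * y) x (S.phi x v) =
      S.phi (a * x) (mfderiv I I (fun y ↦ a * y) x v)

/-- All left and right translations preserve `g`. -/
structure IsBiInvariant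
    (g : ContMDiffRiemannianMetric I ∞ E (fun x : G ↦ TangentSpace I x)) : Prop where
  left : ∀ (a x : G) (v w : TangentSpace I x),
    g.inner (a * x) (mfderiv I I (fun y ↦ a * y) x v) (mfderiv I I (fun y ↦ a * y) x w) =
      g.inner x v w
  right : ∀ (a x : G) (v w : TangentSpace I x),
    g.inner (x * a) (mfderiv I I (fun y ↦ y * a) x v) (mfderiv I I (fun y ↦ y * a) x w) =
      g.inner x v w

end Group

/-! ### Roots of the complexification -/

section Roots

variable {L : Type*} [LieRing L] [LieAlgebra ℝ L] (t : LieSubalgebra ℝ L)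

/-- The space of all `Z` in `ℂ ⊗ L` with `[h, Z] = α(h) Z` for all `h` in `t`. Complex linear
functionals on `ℂ ⊗ t` are given by their restrictions to `t`. -/
def rootSpace (α : t →ₗ[ℝ] ℂ) : Submodule ℂ (ℂ ⊗[ℝ] L) :=
  ⨅ h : t, Module.End.eigenspace (LieAlgebra.ad ℂ (ℂ ⊗[ℝ] L) ((1 : ℂ) ⊗ₜ[ℝ] (h : L))) (α h)

/-- The roots of `ℂ ⊗ L` with respect to `ℂ ⊗ t`. -/
def IsRoot (α : t →ₗ[ℝ] ℂ) : Prop := α ≠ 0 ∧ rootSpace t α ≠ ⊥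

/-- `P` is the set of positive roots: of each root and its negative exactly one is positive, and a
root that is the sum of two positive roots is positive. -/
structure IsPositiveSystem (P : Set (t →ₗ[ℝ] ℂ)) : Prop where
  isRoot : ∀ α ∈ P, IsRoot t α
  pos_or_neg : ∀ α, IsRoot t α → (α ∈ P ↔ -α ∉ P)
  add_mem : ∀ α ∈ P, ∀ β ∈ P, IsRoot t (α + β) → α + β ∈ P

end Roots

end SasakiTorsion

end

noncomputable section

namespace SasakiTorsion

section LinearAlgebra

variable {V : Type*} [NormedAddCommGroup V] [InnerProductSpace ℝ V] [FiniteDimensional ℝ V]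

open Module

/-- In a Lie algebra with invariant inner product, some element has abelian centralizer. -/
theorem exists_abelian_centralizer (b : V →ₗ[ℝ] V →ₗ[ℝ] V)
    (hjac : ∀ x y z, b x (b y z) = b (b x y) z + b y (b x z))
    (hinv : ∀ x y z, inner ℝ (b x y) z = -inner ℝ y (b x z)) :
    ∃ H : V, ∀ x y, b H x = 0 → b H y = 0 → b x y = 0 := by
  set r : V → ℕ := fun H ↦ finrank ℝ (LinearMap.ker (b H)) with hr
  let H := Function.argmin r
  refine ⟨H, fun x y hx hy ↦ ?_⟩
  set K := LinearMap.ker (b H) with hK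
  have hmem : ∀ v, v ∈ K ↔ b H v = 0 := fun v ↦ LinearMap.mem_ker
  have hxK : ∀ p ∈ K, b x p ∈ K := by
    intro p hp
    rw [hmem] at hp ⊢
    rw [hjac, hx, hp]; simp
  have hinj : LinearMap.ker ((b H).domRestrict Kᗮ) = ⊥ := by
    rw [LinearMap.ker_eq_bot']
    rintro ⟨v, hv⟩ h
    have h1 : v ∈ K := (hmem v).2 (by simpa using h)
    have : v ∈ K ⊓ Kᗮ := ⟨h1, hv⟩
    rw [Submodule.inf_orthogonal_eq_bot] at this
    simpa using this
  obtain ⟨c, hc, hanti⟩ := LinearMap.exists_antilipschitzWith _ hinj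
  have hbound : ∀ q ∈ Kᗮ, ‖q‖ ≤ c * ‖b H q‖ := by
    intro q hq
    have := hanti.le_mul_dist ⟨q, hq⟩ 0
    simpa [dist_eq_norm] using this
  set C := ‖(b x).toContinuousLinearMap‖ with hC
  have hC0 : 0 ≤ C := norm_nonneg _
  have hxb : ∀ q, ‖b x q‖ ≤ C * ‖q‖ := fun q ↦ (b x).toContinuousLinearMap.le_opNorm q
  have hc' : (0 : ℝ) < c := by exact_mod_cast hc
  set s : ℝ := 1 / (2 * c * (C + 1)) with hs
  have hs0 : 0 < s := by positivity
  have hle : LinearMap.ker (b (H + s • x)) ≤ K ⊓ LinearMap.ker (b x) := by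
    intro v hv
    obtain ⟨p, hp, q, hq, rfl⟩ := K.exists_add_mem_mem_orthogonal v
    have hp' := (hmem p).1 hp
    have hDq : b H q ∈ Kᗮ := by
      rw [Submodule.mem_orthogonal]
      intro k hk
      rw [real_inner_comm, hinv, (hmem k).1 hk]; simp
    have hxq : b x q ∈ Kᗮ := by
      rw [Submodule.mem_orthogonal]
      intro k hk
      rw [real_inner_comm, hinv, real_inner_comm, hq _ (hxK k hk), neg_zero]
    have hsum : s • b x p + (b H q + s • b x q) = 0 := by
      have := LinearMap.mem_ker.1 hv
      simp only [map_add, map_smul, LinearMap.add_apply, LinearMap.smul_apply, hp'] at this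
      rw [← this]; module
    have hm : s • b x p ∈ K ⊓ Kᗮ := by
      refine ⟨K.smul_mem _ (hxK p hp), ?_⟩
      rw [eq_neg_of_add_eq_zero_left hsum]
      exact Kᗮ.neg_mem (Kᗮ.add_mem hDq (Kᗮ.smul_mem _ hxq))
    rw [Submodule.inf_orthogonal_eq_bot, Submodule.mem_bot] at hm
    rw [hm, zero_add] at hsum
    have hq0 : q = 0 := by
      have h1 := hbound q hq
      rw [eq_neg_of_add_eq_zero_left hsum, norm_neg, norm_smul, Real.norm_of_nonneg hs0.le] at h1
      have h2 := hxb q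
      have h3 : ‖q‖ ≤ c * (s * (C * ‖q‖)) := h1.trans (by gcongr)
      have h4 : c * (s * (C * ‖q‖)) ≤ 1 / 2 * ‖q‖ := by
        have : c * s * C ≤ 1 / 2 := by
          rw [hs]
          rw [show c * (1 / (2 * c * (C + 1))) * C = C / (C + 1) / 2 by field_simp]
          have : C / (C + 1) ≤ 1 := by rw [div_le_one (by positivity)]; linarith
          linarith
        nlinarith [norm_nonneg q]
      have := norm_nonneg q
      exact norm_eq_zero.1 (by linarith)
    subst hq0
    rw [add_zero]
    exact ⟨hp, LinearMap.mem_ker.2 ((smul_eq_zero_iff_right hs0.ne').1 hm)⟩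
  have h1 : finrank ℝ K ≤ finrank ℝ (K ⊓ LinearMap.ker (b x) : Submodule ℝ V) :=
    (Function.argmin_le r (H + s • x)).trans (Submodule.finrank_mono hle)
  have h2 := Submodule.eq_of_le_of_finrank_le inf_le_left h1
  have : y ∈ K ⊓ LinearMap.ker (b x) := h2.symm.le ((hmem y).2 hy)
  exact LinearMap.mem_ker.1 this.2

/-- For a skew `D`, every vector is a sum of vectors killed by `D` and of vectors on which `D ^ 2`
is a negative scalar. -/
theorem skew_induction (D : V →ₗ[ℝ] V) (hD : ∀ x y, inner ℝ (D x) y = -inner ℝ x (D y))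
    {p : V → Prop} (hadd : ∀ x y, p x → p y → p (x + y))
    (h0 : ∀ x, D x = 0 → p x)
    (hpos : ∀ a : ℝ, 0 < a → ∀ x, D (D x) = -(a ^ 2) • x → p x) (v : V) : p v := by
  have htop : (⨆ μ : ℝ, End.eigenspace (D * D) μ) = ⊤ := by
    have hsymm : (D * D).IsSymmetric := fun x y ↦ by simp [hD]
    rw [← Submodule.orthogonal_eq_bot_iff]
    exact hsymm.orthogonalComplement_iSup_eigenspaces_eq_bot
  have hv : v ∈ ⨆ μ : ℝ, End.eigenspace (D * D) μ := htop ▸ Submodule.mem_top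
  refine Submodule.iSup_induction (motive := p) _ hv (fun μ x hx ↦ ?_) (h0 0 (map_zero D)) hadd
  rw [End.mem_eigenspace_iff] at hx
  have hx' : D (D x) = μ • x := hx
  have hn : μ * ‖x‖ ^ 2 = -‖D x‖ ^ 2 := by
    have := hD (D x) x
    rw [hx', real_inner_smul_left, real_inner_self_eq_norm_sq, real_inner_self_eq_norm_sq] at this
    exact this
  by_cases hμ : μ < 0
  · refine hpos (Real.sqrt (-μ)) (Real.sqrt_pos.2 (by linarith)) x ?_
    rw [Real.sq_sqrt (by linarith), neg_neg, hx']
  · refine h0 x (norm_eq_zero.1 ?_)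
    have : 0 ≤ μ * ‖x‖ ^ 2 := mul_nonneg (not_lt.1 hμ) (by positivity)
    have h2 : ‖D x‖ ^ 2 = 0 := le_antisymm (by linarith) (by positivity)
    exact pow_eq_zero_iff (two_ne_zero) |>.1 h2

/-- The partial isometry in the polar decomposition of a skew map. -/
theorem exists_polar (D : V →ₗ[ℝ] V) : ∃ f : V →ₗ[ℝ] V, (∀ x, D x = 0 → f x = 0) ∧
    ∀ a : ℝ, 0 < a → ∀ x, D (D x) = -(a ^ 2) • x → f x = a⁻¹ • D x := by
  classical
  have hfin := End.finite_hasEigenvalue (D * D)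
  let s : Finset ℝ := hfin.toFinset
  let q : Polynomial ℝ := Lagrange.interpolate s id (fun μ ↦ (Real.sqrt (-μ))⁻¹)
  have hq : ∀ μ ∈ s, q.eval μ = (Real.sqrt (-μ))⁻¹ := fun μ hμ ↦
    Lagrange.eval_interpolate_at_node (v := id) _ (fun _ _ _ _ h ↦ h) hμ
  refine ⟨D ∘ₗ Polynomial.aeval (D * D) q, fun x hx ↦ ?_, fun a ha x hx ↦ ?_⟩
  · by_cases h : x = 0
    · simp [h]
    have : End.HasEigenvector (D * D) 0 x := by
      refine ⟨End.mem_eigenspace_iff.2 ?_, h⟩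
      simp [hx]
    rw [LinearMap.comp_apply, End.aeval_apply_of_hasEigenvector this, map_smul, hx, smul_zero]
  · by_cases h : x = 0
    · simp [h]
    have : End.HasEigenvector (D * D) (-(a ^ 2)) x := by
      exact ⟨End.mem_eigenspace_iff.2 hx, h⟩
    rw [LinearMap.comp_apply, End.aeval_apply_of_hasEigenvector this, map_smul, hq, neg_neg,
      Real.sqrt_sq ha.le]
    exact hfin.mem_toFinset.2 (End.hasEigenvalue_of_hasEigenvector this)

/-- An odd-dimensional Euclidean space carries a unit vector and an orthogonal complex structure on
its orthogonal complement. -/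
theorem exists_contact_structure (hodd : Odd (finrank ℝ V)) :
    ∃ (ξ : V) (J : V →ₗ[ℝ] V), inner ℝ ξ ξ = 1 ∧ J ξ = 0 ∧
      (∀ x, J (J x) = -x + inner ℝ ξ x • ξ) ∧ ∀ x y, inner ℝ (J x) y = -inner ℝ x (J y) := by
  obtain ⟨k, hk⟩ := hodd
  let ι := Unit ⊕ (Fin k ⊕ Fin k)
  have hcard : Fintype.card (Fin (finrank ℝ V)) = Fintype.card ι := by
    simp [ι, hk]; ring
  let e : V ≃ₗᵢ[ℝ] EuclideanSpace ℝ ι :=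
    ((stdOrthonormalBasis ℝ V).reindex (Fintype.equivOfCardEq hcard)).repr
  let J₀ : EuclideanSpace ℝ ι →ₗ[ℝ] EuclideanSpace ℝ ι :=
    { toFun := fun f ↦ WithLp.toLp 2 (Sum.elim (fun _ ↦ 0)
        (Sum.elim (fun i ↦ -f (.inr (.inr i))) fun i ↦ f (.inr (.inl i))))
      map_add' := fun f g ↦ by
        ext i; rcases i with i | i | i <;> simp; ring
      map_smul' := fun c f ↦ by
        ext i; rcases i with i | i | i <;> simp }
  let ξ₀ : EuclideanSpace ℝ ι := EuclideanSpace.single (.inl ()) 1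
  refine ⟨e.symm ξ₀, e.symm.toLinearEquiv.toLinearMap ∘ₗ J₀ ∘ₗ e.toLinearEquiv.toLinearMap,
    ?_, ?_, fun x ↦ ?_, fun x y ↦ ?_⟩
  · rw [LinearIsometryEquiv.inner_map_map]
    simp [ξ₀]
  · have : J₀ ξ₀ = 0 := by
      ext i; rcases i with i | i | i <;> simp [J₀, ξ₀]
    simp [this]
  · apply e.injective
    have : inner ℝ (e.symm ξ₀) x = inner ℝ ξ₀ (e x) := by
      rw [← e.inner_map_map, e.apply_symm_apply]
    rw [this]
    simp only [LinearMap.comp_apply, LinearEquiv.coe_coe, LinearIsometryEquiv.coe_toLinearEquiv,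
      LinearIsometryEquiv.apply_symm_apply, map_add, map_neg, map_smul]
    ext i
    rcases i with i | i | i <;> simp [J₀, ξ₀, EuclideanSpace.inner_single_left]
  · have h1 : ∀ f g, inner ℝ (J₀ f) g = -inner ℝ f (J₀ g) := by
      intro f g
      simp [PiLp.inner_apply, J₀, ι, mul_comm]
    have h2 := h1 (e x) (e y)
    rw [← e.inner_map_map, ← e.inner_map_map x]
    simpa using h2

end LinearAlgebra

section LinearAlgebra

variable {V : Type*} [NormedAddCommGroup V] [InnerProductSpace ℝ V] [FiniteDimensional ℝ V]

open Module

/-- The polar part of a skew map `D` is skew, commutes with `D`, and is a complex structure on the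
orthogonal complement of `ker D`. -/
theorem exists_skew_polar (D : V →ₗ[ℝ] V) (hD : ∀ x y, inner ℝ (D x) y = -inner ℝ x (D y)) :
    ∃ f : V →ₗ[ℝ] V, (∀ x, D x = 0 → f x = 0) ∧
      (∀ a : ℝ, 0 < a → ∀ x, D (D x) = -(a ^ 2) • x → f x = a⁻¹ • D x) ∧
      (∀ x y, inner ℝ (f x) y = -inner ℝ x (f y)) ∧
      ∀ x ∈ (LinearMap.ker D)ᗮ, f (f x) = -x := by
  obtain ⟨f, hf0, hfa⟩ := exists_polar D
  have hff : ∀ a : ℝ, 0 < a → ∀ x, D (D x) = -(a ^ 2) • x → f (f x) = -x := by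
    intro a ha x hx
    rw [hfa a ha x hx, map_smul, hfa a ha (D x) (by rw [hx, map_smul]), hx, smul_smul, smul_smul]
    rw [show a⁻¹ * a⁻¹ * -(a ^ 2) = -1 by field_simp]
    simp
  have hmem : ∀ a : ℝ, 0 < a → ∀ x, D (D x) = -(a ^ 2) • x → x ∈ (LinearMap.ker D)ᗮ := by
    intro a ha x hx
    rw [Submodule.mem_orthogonal]
    intro k hk
    have h1 := hD k (D x)
    rw [LinearMap.mem_ker.1 hk, inner_zero_left, hx, real_inner_smul_right] at h1
    have : a ^ 2 ≠ 0 := by positivity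
    have h2 : a ^ 2 * inner ℝ k x = 0 := by linarith
    exact (mul_eq_zero.1 h2).resolve_left this
  have hskew : ∀ x y, inner ℝ (f x) y = -inner ℝ x (f y) := by
    intro x y
    refine skew_induction D hD (p := fun x ↦ inner ℝ (f x) y = -inner ℝ x (f y)) ?_ ?_ ?_ x
    · intro u v hu hv
      rw [map_add, inner_add_left, inner_add_left, hu, hv]; ring
    · intro u hu
      rw [hf0 u hu, inner_zero_left]
      refine skew_induction D hD (p := fun y ↦ 0 = -inner ℝ u (f y)) ?_ ?_ ?_ y
      · intro v w hv hw
        rw [map_add, inner_add_right]; linarith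
      · intro v hv; simp [hf0 v hv]
      · intro a ha v hv
        rw [hfa a ha v hv, real_inner_smul_right]
        have := hD u v
        rw [hu, inner_zero_left] at this
        rw [neg_eq_zero.1 this.symm]; simp
    · intro a ha u hu
      rw [hfa a ha u hu, real_inner_smul_left, hD]
      refine skew_induction D hD
        (p := fun y ↦ a⁻¹ * -inner ℝ u (D y) = -inner ℝ u (f y)) ?_ ?_ ?_ y
      · intro v w hv hw
        rw [map_add, map_add, inner_add_right, inner_add_right]; linarith
      · intro v hv; simp [hf0 v hv, hv]
      · intro c hc v hv
        rw [hfa c hc v hv, real_inner_smul_right]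
        by_cases hac : a = c
        · rw [hac]; ring
        have h1 : inner ℝ (D (D u)) (D v) = inner ℝ u (D (D (D v))) := by
          rw [hD, hD, neg_neg]
        rw [hu, hv, map_smul, real_inner_smul_left, real_inner_smul_right] at h1
        have h2 : (a - c) * (a + c) * inner ℝ u (D v) = 0 := by linarith
        have h3 : (a - c) * (a + c) ≠ 0 :=
          mul_ne_zero (sub_ne_zero.2 hac) (by positivity)
        rw [(mul_eq_zero.1 h2).resolve_left h3]; simp
  refine ⟨f, hf0, hfa, hskew, fun x hx ↦ ?_⟩
  have key : ∀ x, f (f x) + x ∈ LinearMap.ker D := by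
    intro x
    refine skew_induction D hD (p := fun x ↦ f (f x) + x ∈ LinearMap.ker D) ?_ ?_ ?_ x
    · intro u v hu hv
      have := Submodule.add_mem _ hu hv
      convert this using 1
      simp only [map_add]; abel
    · intro u hu; simpa [hf0 u hu] using hu
    · intro a ha u hu
      simp [hff a ha u hu]
  have h2 : f (f x) ∈ (LinearMap.ker D)ᗮ := by
    rw [Submodule.mem_orthogonal]
    intro k hk
    rw [real_inner_comm, hskew, hf0 k hk]; simp
  have h3 : f (f x) + x ∈ LinearMap.ker D ⊓ (LinearMap.ker D)ᗮ := ⟨key x, Submodule.add_mem _ h2 hx⟩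
  rw [Submodule.inf_orthogonal_eq_bot, Submodule.mem_bot] at h3
  exact eq_neg_of_add_eq_zero_left h3

/-- A real vector space with a complex structure has even dimension. -/
theorem even_finrank_of_sq_eq_neg {W : Type*} [AddCommGroup W] [Module ℝ W] [FiniteDimensional ℝ W]
    (T : W →ₗ[ℝ] W) (hT : ∀ x, T (T x) = -x) : Even (finrank ℝ W) := by
  have h : T ∘ₗ T = (-1 : ℝ) • LinearMap.id := by
    ext x; simp [hT]
  have h2 := congrArg LinearMap.det h
  rw [LinearMap.det_comp, LinearMap.det_smul, LinearMap.det_id, mul_one] at h2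
  by_contra hodd
  rw [Nat.not_even_iff_odd] at hodd
  rw [hodd.neg_one_pow] at h2
  nlinarith [mul_self_nonneg (LinearMap.det T)]

/-- The algebraic model of a left-invariant normal almost contact metric structure on a Lie algebra
with invariant inner product. -/
theorem exists_algebraic_structure (b : V →ₗ[ℝ] V →ₗ[ℝ] V)
    (hskew : ∀ x y, b x y = -b y x)
    (hjac : ∀ x y z, b x (b y z) = b (b x y) z + b y (b x z))
    (hinv : ∀ x y z, inner ℝ (b x y) z = -inner ℝ y (b x z))
    (hodd : Odd (finrank ℝ V)) :
    ∃ (H ξ : V) (φ : V →ₗ[ℝ] V),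
      (∀ x y, b H x = 0 → b H y = 0 → b x y = 0) ∧
      b H ξ = 0 ∧ (∀ x, b H x = 0 → b H (φ x) = 0) ∧
      inner ℝ ξ ξ = 1 ∧ φ ξ = 0 ∧ (∀ x, φ (φ x) = -x + inner ℝ ξ x • ξ) ∧
      (∀ x y, inner ℝ (φ x) y = -inner ℝ x (φ y)) ∧
      (∀ x y, b (φ x) (φ y) - b x y - φ (b (φ x) y) - φ (b x (φ y)) = 0) ∧
      (∀ a : ℝ, 0 < a → ∀ x, b H (b H x) = -(a ^ 2) • x → φ x = a⁻¹ • b H x) := by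
  obtain ⟨H, hab⟩ := exists_abelian_centralizer b hjac hinv
  set K := LinearMap.ker (b H) with hK
  have hmem : ∀ v, v ∈ K ↔ b H v = 0 := fun v ↦ LinearMap.mem_ker
  have hDs : ∀ x y, inner ℝ (b H x) y = -inner ℝ x (b H y) := hinv H
  obtain ⟨f, hf0, hfa, hfs, hff⟩ := exists_skew_polar (b H) hDs
  have hfK : ∀ x, f x ∈ Kᗮ := by
    intro x
    rw [Submodule.mem_orthogonal]
    intro k hk
    rw [real_inner_comm, hfs, hf0 k hk]; simp
  have hoddK : Odd (finrank ℝ K) := by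
    have h1 : Even (finrank ℝ Kᗮ) := by
      refine even_finrank_of_sq_eq_neg ((f.comp Kᗮ.subtype).codRestrict Kᗮ fun x ↦ hfK x) ?_
      intro x
      ext
      exact hff x x.2
    have h2 := K.finrank_add_finrank_orthogonal
    rw [← h2] at hodd
    exact (Nat.odd_add.1 hodd).2 h1
  obtain ⟨ξ, J, hξ, hJξ, hJJ, hJs⟩ := exists_contact_structure (V := K) hoddK
  let P : V →ₗ[ℝ] K := K.orthogonalProjectionOnto.toLinearMap
  have hPK : ∀ k : K, P k = k := fun k ↦ K.orthogonalProjectionOnto_mem_subspace_eq_self k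
  have hPo : ∀ x ∈ Kᗮ, P x = 0 := fun x hx ↦
    K.orthogonalProjectionOnto_apply_of_mem_orthogonal hx
  let φ : V →ₗ[ℝ] V := f + K.subtype ∘ₗ J ∘ₗ P
  have hφK : ∀ k : K, φ k = J k := by
    intro k
    simp [φ, hPK, hf0 k ((hmem _).1 k.2)]
  have hφo : ∀ x ∈ Kᗮ, φ x = f x := by
    intro x hx
    simp [φ, hPo x hx]
  have hea : ∀ a : ℝ, 0 < a → ∀ x, b H (b H x) = -(a ^ 2) • x → x ∈ Kᗮ := by
    intro a ha x hx
    rw [Submodule.mem_orthogonal]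
    intro k hk
    have h1 := hDs k (b H x)
    rw [(hmem k).1 hk, inner_zero_left, hx, real_inner_smul_right] at h1
    have : a ^ 2 ≠ 0 := by positivity
    have h2 : a ^ 2 * inner ℝ k x = 0 := by linarith
    exact (mul_eq_zero.1 h2).resolve_left this
  have hφa : ∀ a : ℝ, 0 < a → ∀ x, b H (b H x) = -(a ^ 2) • x → φ x = a⁻¹ • b H x :=
    fun a ha x hx ↦ by rw [hφo x (hea a ha x hx), hfa a ha x hx]
  have hφKK : ∀ x, b H x = 0 → b H (φ x) = 0 := by
    intro x hx
    have := hφK ⟨x, (hmem x).2 hx⟩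
    simp only at this
    rw [this]
    exact (hmem _).1 (J _).2
  have hφφ : ∀ x, φ (φ x) = -x + inner ℝ (ξ : V) x • (ξ : V) := by
    intro x
    obtain ⟨p, hp, q, hq, rfl⟩ := K.exists_add_mem_mem_orthogonal x
    have h1 := hφK ⟨p, hp⟩
    simp only at h1
    rw [map_add, h1, hφo q hq, map_add, hφK, hφo _ (hfK q), hff q hq, hJJ, inner_add_right,
      hq ξ ξ.2]
    simp only [Submodule.coe_add, Submodule.coe_neg, Submodule.coe_smul, Submodule.coe_inner]
    module
  have hφs : ∀ x y, inner ℝ (φ x) y = -inner ℝ x (φ y) := by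
    intro x y
    obtain ⟨p, hp, q, hq, rfl⟩ := K.exists_add_mem_mem_orthogonal x
    obtain ⟨p', hp', q', hq', rfl⟩ := K.exists_add_mem_mem_orthogonal y
    have h1 := hφK ⟨p, hp⟩
    have h2 := hφK ⟨p', hp'⟩
    simp only at h1 h2
    rw [map_add, h1, hφo q hq, map_add, h2, hφo _ hq']
    have h3 := hJs ⟨p, hp⟩ ⟨p', hp'⟩
    simp only [Submodule.coe_inner] at h3
    simp only [inner_add_left, inner_add_right]
    have e1 : inner ℝ (f q) p' = 0 := by rw [hfs, hf0 p' ((hmem _).1 hp')]; simp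
    have e2 : inner ℝ q (J ⟨p', hp'⟩ : V) = 0 := by rw [real_inner_comm, hq _ (J _).2]
    linarith [hfs q q', hq' _ (J ⟨p, hp⟩).2, hfK q' p hp]
  refine ⟨H, ξ, φ, hab, (hmem _).1 ξ.2, hφKK, hξ, by rw [hφK, hJξ]; rfl, hφφ, hφs, ?_, hφa⟩
  -- vanishing of the Nijenhuis-type tensor, on pairs of eigenvectors
  have hcomm : ∀ h, b H h = 0 → ∀ x, b H (b h x) = b h (b H x) := by
    intro h hh x
    rw [hjac H h x, hh]; simp
  have hN1 : ∀ h, b H h = 0 → ∀ y,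
      b (φ h) (φ y) - b h y - φ (b (φ h) y) - φ (b h (φ y)) = 0 := by
    intro h hh y
    refine skew_induction (b H) hDs
      (p := fun y ↦ b (φ h) (φ y) - b h y - φ (b (φ h) y) - φ (b h (φ y)) = 0) ?_ ?_ ?_ y
    · intro u v hu hv
      simp only [map_add]
      have h := congrArg₂ (· + ·) hu hv
      simp only [add_zero] at h
      refine Eq.trans ?_ h
      abel
    · intro u hu
      rw [hab _ _ (hφKK h hh) (hφKK u hu), hab _ _ hh hu, hab _ _ (hφKK h hh) hu,
        hab _ _ hh (hφKK u hu)]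
      simp
    · intro a ha u hu
      have hE : ∀ k, b H k = 0 → b H (b H (b k u)) = -(a ^ 2) • b k u := by
        intro k hk
        rw [hcomm k hk, hcomm k hk, hu, map_smul]
      have hc : ∀ k, b H k = 0 → b k (φ u) = φ (b k u) := by
        intro k hk
        rw [hφa a ha u hu, hφa a ha _ (hE k hk), map_smul, hcomm k hk]
      rw [hc _ (hφKK h hh), hc h hh, hφφ, hea a ha _ (hE h hh) ξ ξ.2]
      simp
  intro x y
  refine skew_induction (b H) hDs
    (p := fun x ↦ b (φ x) (φ y) - b x y - φ (b (φ x) y) - φ (b x (φ y)) = 0) ?_ ?_ ?_ x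
  · intro u v hu hv
    simp only [map_add, LinearMap.add_apply]
    have h := congrArg₂ (· + ·) hu hv
    simp only [add_zero] at h
    refine Eq.trans ?_ h
    abel
  · exact fun u hu ↦ hN1 u hu y
  intro a ha x hx
  refine skew_induction (b H) hDs
    (p := fun y ↦ b (φ x) (φ y) - b x y - φ (b (φ x) y) - φ (b x (φ y)) = 0) ?_ ?_ ?_ y
  · intro u v hu hv
    simp only [map_add]
    have h := congrArg₂ (· + ·) hu hv
    simp only [add_zero] at h
    refine Eq.trans ?_ h
    abel
  · intro h hh
    have := hN1 h hh x
    rw [hskew (φ x), hskew x, hskew (φ x), hskew x]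
    rw [← neg_eq_zero, ← this]
    simp only [map_neg]
    abel
  intro c hc y hy
  have hD : ∀ a : ℝ, 0 < a → ∀ x, b H (b H x) = -(a ^ 2) • x →
      b H x = a • φ x ∧ b H (φ x) = -a • x := by
    intro a ha x hx
    constructor
    · rw [hφa a ha x hx, smul_smul, mul_inv_cancel₀ ha.ne', one_smul]
    · rw [hφa a ha x hx, map_smul, hx, smul_smul]
      congr 1; field_simp
  obtain ⟨hx1, hx2⟩ := hD a ha x hx
  obtain ⟨hy1, hy2⟩ := hD c hc y hy
  set A := b x y - b (φ x) (φ y) with hA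
  set B := b (φ x) y + b x (φ y) with hB
  have hDA : b H A = (a + c) • B := by
    rw [hA, map_sub, hjac H x y, hjac H (φ x) (φ y), hx1, hx2, hy1, hy2, hB]
    simp only [map_smul, LinearMap.smul_apply]
    module
  have hDB : b H B = -(a + c) • A := by
    rw [hB, map_add, hjac H (φ x) y, hjac H x (φ y), hx1, hx2, hy1, hy2, hA]
    simp only [map_smul, LinearMap.smul_apply]
    module
  have hac : 0 < a + c := by positivity
  have hEB : b H (b H B) = -((a + c) ^ 2) • B := by
    rw [hDB, map_smul, hDA, smul_smul]; congr 1; ring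
  have hφB : φ B = -A := by
    rw [hφa _ hac B hEB, hDB, smul_smul]
    rw [show (a + c)⁻¹ * -(a + c) = -1 by field_simp]
    simp
  have : b (φ x) (φ y) - b x y - φ (b (φ x) y) - φ (b x (φ y)) = -A - φ B := by
    rw [hA, hB, map_add]; abel
  rw [this, hφB]; simp

end LinearAlgebra

section Roots

open Module

variable {L : Type*} [LieRing L] [LieAlgebra ℝ L]

/-- Elements of the complexification are of the form `1 ⊗ x + i ⊗ y`. -/
theorem exists_eq_re_add_im {W : Type*} [AddCommGroup W] [Module ℝ W] (Z : ℂ ⊗[ℝ] W) :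
    ∃ x y : W, Z = (1 : ℂ) ⊗ₜ[ℝ] x + Complex.I ⊗ₜ[ℝ] y := by
  induction Z using TensorProduct.induction_on with
  | zero => exact ⟨0, 0, by simp⟩
  | tmul z w =>
    refine ⟨z.re • w, z.im • w, ?_⟩
    rw [← TensorProduct.smul_tmul, ← TensorProduct.smul_tmul, ← TensorProduct.add_tmul]
    congr 1
    apply Complex.ext <;> simp
  | add Z W hZ hW =>
    obtain ⟨x, y, rfl⟩ := hZ
    obtain ⟨x', y', rfl⟩ := hW
    refine ⟨x + x', y + y', ?_⟩
    rw [TensorProduct.tmul_add, TensorProduct.tmul_add]; abel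

/-- The decomposition `1 ⊗ x + i ⊗ y` is unique. -/
theorem re_add_im_inj {W : Type*} [AddCommGroup W] [Module ℝ W] {x y x' y' : W} :
    (1 : ℂ) ⊗ₜ[ℝ] x + Complex.I ⊗ₜ[ℝ] y = (1 : ℂ) ⊗ₜ[ℝ] x' + Complex.I ⊗ₜ[ℝ] y' ↔
      x = x' ∧ y = y' := by
  refine ⟨fun h ↦ ?_, fun h ↦ by rw [h.1, h.2]⟩
  have h1 := congrArg (TensorProduct.lift
    ((LinearMap.lsmul ℝ W).comp Complex.reLm)) h
  have h2 := congrArg (TensorProduct.lift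
    ((LinearMap.lsmul ℝ W).comp Complex.imLm)) h
  simp at h1 h2
  exact ⟨h1, h2⟩

theorem smul_re_add_im {W : Type*} [AddCommGroup W] [Module ℝ W] (z : ℂ) (x y : W) :
    z • ((1 : ℂ) ⊗ₜ[ℝ] x + Complex.I ⊗ₜ[ℝ] y) =
      (1 : ℂ) ⊗ₜ[ℝ] (z.re • x - z.im • y) + Complex.I ⊗ₜ[ℝ] (z.im • x + z.re • y) := by
  simp only [smul_add, TensorProduct.smul_tmul', TensorProduct.tmul_sub, TensorProduct.tmul_add,
    ← TensorProduct.smul_tmul]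
  have h1 : (z • (1 : ℂ)) = z.re • (1 : ℂ) + z.im • Complex.I := by
    apply Complex.ext <;> simp
  have h2 : (z • Complex.I) = -(z.im • (1 : ℂ)) + z.re • Complex.I := by
    apply Complex.ext <;> simp
  rw [h1, h2, TensorProduct.add_tmul, TensorProduct.add_tmul, TensorProduct.neg_tmul]
  abel

/-- Membership in a root space, in terms of real and imaginary parts. -/
theorem mem_rootSpace_iff (t : LieSubalgebra ℝ L) (α : t →ₗ[ℝ] ℂ) (x y : L) :
    (1 : ℂ) ⊗ₜ[ℝ] x + Complex.I ⊗ₜ[ℝ] y ∈ rootSpace t α ↔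
      ∀ h : t, ⁅(h : L), x⁆ = (α h).re • x - (α h).im • y ∧
        ⁅(h : L), y⁆ = (α h).im • x + (α h).re • y := by
  simp only [rootSpace, Submodule.mem_iInf, End.mem_eigenspace_iff, LieAlgebra.ad_apply,
    smul_re_add_im, lie_add, LieAlgebra.ExtendScalars.bracket_tmul, one_mul, re_add_im_inj]

variable (B : L →ₗ[ℝ] L →ₗ[ℝ] ℝ)

/-- The Cartan subalgebra and positive roots determined by an element `H` with abelian centralizer
in a Lie algebra with an invariant inner product. -/
theorem exists_cartan_positive (hsymm : ∀ x y, B x y = B y x) (hpos : ∀ x, x ≠ 0 → 0 < B x x)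
    (hinv : ∀ x y z : L, B ⁅x, y⁆ z = -B y ⁅x, z⁆) (H : L)
    (hab : ∀ x y : L, ⁅H, x⁆ = 0 → ⁅H, y⁆ = 0 → ⁅x, y⁆ = 0)
    (φ : L →ₗ[ℝ] L) (hφ : ∀ a : ℝ, 0 < a → ∀ x, ⁅H, ⁅H, x⁆⁆ = -(a ^ 2) • x → φ x = a⁻¹ • ⁅H, x⁆) :
    ∃ (t : LieSubalgebra ℝ L) (P : Set (t →ₗ[ℝ] ℂ)),
      t.IsCartanSubalgebra ∧ IsPositiveSystem t P ∧ (∀ x, x ∈ t ↔ ⁅H, x⁆ = 0) ∧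
      (∀ α ∈ P, ∀ Z ∈ rootSpace t α, LinearMap.baseChange ℂ φ Z = Complex.I • Z) ∧
      (∀ α ∈ P, ∀ Z ∈ rootSpace t (-α), LinearMap.baseChange ℂ φ Z = -Complex.I • Z) := by
  have hBz : ∀ x, B x x = 0 → x = 0 := fun x hx ↦ by
    by_contra h; exact (hpos x h).ne' hx
  let t : LieSubalgebra ℝ L :=
    { LinearMap.ker (LieAlgebra.ad ℝ L H) with
      lie_mem' := by
        intro x y hx hy
        have hx' : ⁅H, x⁆ = 0 := by simpa using hx
        have hy' : ⁅H, y⁆ = 0 := by simpa using hy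
        have : ⁅H, ⁅x, y⁆⁆ = 0 := by rw [hab x y hx' hy', lie_zero]
        simpa using this }
  have hmem : ∀ x, x ∈ t ↔ ⁅H, x⁆ = 0 := fun x ↦ by
    change x ∈ LinearMap.ker (LieAlgebra.ad ℝ L H) ↔ _
    simp
  have hHt : H ∈ t := (hmem H).2 (lie_self H)
  let H₀ : t := ⟨H, hHt⟩
  let P : Set (t →ₗ[ℝ] ℂ) := {α | IsRoot t α ∧ 0 < (α H₀).im}
  have hre : ∀ α x y, (x ≠ 0 ∨ y ≠ 0) → (1 : ℂ) ⊗ₜ[ℝ] x + Complex.I ⊗ₜ[ℝ] y ∈ rootSpace t α →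
      ∀ h : t, (α h).re = 0 := by
    intro α x y hxy hZ h
    rw [mem_rootSpace_iff] at hZ
    obtain ⟨h1, h2⟩ := hZ h
    have hs : ∀ v, B ⁅(h : L), v⁆ v = 0 := fun v ↦ by
      have := hinv h v v
      rw [hsymm v] at this; linarith
    have e1 := hs x
    have e2 := hs y
    rw [h1] at e1
    rw [h2] at e2
    simp only [map_sub, map_add, map_smul, LinearMap.sub_apply, LinearMap.add_apply,
      LinearMap.smul_apply, smul_eq_mul] at e1 e2
    rw [hsymm y x] at e1
    have e3 : (α h).re * (B x x + B y y) = 0 := by linarith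
    have hn : ∀ v, 0 ≤ B v v := fun v ↦ by
      by_cases hv : v = 0
      · simp [hv]
      · exact (hpos v hv).le
    refine (mul_eq_zero.1 e3).resolve_right (ne_of_gt ?_)
    rcases hxy with hx | hy
    · linarith [hpos x hx, hn y]
    · linarith [hpos y hy, hn x]
  have hex : ∀ α, IsRoot t α → ∃ x y, (x ≠ 0 ∨ y ≠ 0) ∧
      (1 : ℂ) ⊗ₜ[ℝ] x + Complex.I ⊗ₜ[ℝ] y ∈ rootSpace t α := by
    intro α hα
    obtain ⟨Z, hZ, hZ0⟩ := (Submodule.ne_bot_iff _).1 hα.2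
    obtain ⟨x, y, rfl⟩ := exists_eq_re_add_im Z
    refine ⟨x, y, ?_, hZ⟩
    by_contra! hc
    exact hZ0 (by simp [hc.1, hc.2])
  have hroot_re : ∀ α, IsRoot t α → ∀ h : t, (α h).re = 0 := fun α hα ↦ by
    obtain ⟨x, y, hxy, hZ⟩ := hex α hα
    exact hre α x y hxy hZ
  have hroot_im : ∀ α, IsRoot t α → (α H₀).im ≠ 0 := by
    intro α hα him
    obtain ⟨x, y, hxy, hZ⟩ := hex α hα
    have hZ' := (mem_rootSpace_iff t α x y).1 hZ
    obtain ⟨h1, h2⟩ := hZ' H₀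
    rw [him, hroot_re α hα] at h1 h2
    simp only [zero_smul, sub_zero, add_zero] at h1 h2
    apply hα.1
    ext h
    obtain ⟨h3, h4⟩ := hZ' h
    rw [hroot_re α hα] at h3 h4
    rw [hab h x ((hmem _).1 h.2) h1] at h3
    rw [hab h y ((hmem _).1 h.2) h2] at h4
    simp only [zero_smul, zero_sub, add_zero] at h3 h4
    apply Complex.ext
    · exact hroot_re α hα h
    · rcases hxy with hx | hy
      · exact (smul_eq_zero.1 h4.symm).resolve_right hx
      · exact (smul_eq_zero.1 (neg_eq_zero.1 h3.symm)).resolve_right hy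
  have hroot_neg : ∀ α, IsRoot t α → IsRoot t (-α) := by
    intro α hα
    refine ⟨neg_ne_zero.2 hα.1, ?_⟩
    obtain ⟨x, y, hxy, hZ⟩ := hex α hα
    rw [Submodule.ne_bot_iff]
    refine ⟨(1 : ℂ) ⊗ₜ[ℝ] x + Complex.I ⊗ₜ[ℝ] (-y), ?_, ?_⟩
    · rw [mem_rootSpace_iff] at hZ ⊢
      intro h
      obtain ⟨h3, h4⟩ := hZ h
      rw [hroot_re α hα] at h3 h4
      simp only [LinearMap.neg_apply, Complex.neg_re, Complex.neg_im, lie_neg, h3, h4,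
        hroot_re α hα]
      constructor <;> module
    · intro h0
      have : (1 : ℂ) ⊗ₜ[ℝ] x + Complex.I ⊗ₜ[ℝ] (-y) =
          (1 : ℂ) ⊗ₜ[ℝ] (0 : L) + Complex.I ⊗ₜ[ℝ] (0 : L) := by rw [h0]; simp
      obtain ⟨e1, e2⟩ := re_add_im_inj.1 this
      rcases hxy with hx | hy
      · exact hx e1
      · exact hy (neg_eq_zero.1 e2)
  have hφ' : ∀ a : ℝ, 0 < a → ∀ x y, ⁅H, x⁆ = -a • y → ⁅H, y⁆ = a • x → φ x = -y ∧ φ y = x := by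
    intro a ha x y h1 h2
    constructor
    · rw [hφ a ha x (by rw [h1, lie_smul, h2, smul_smul]; congr 1; ring), h1, smul_smul]
      rw [show a⁻¹ * -a = -1 by field_simp]; simp
    · rw [hφ a ha y (by rw [h2, lie_smul, h1, smul_smul]; congr 1; ring), h2, smul_smul,
        inv_mul_cancel₀ ha.ne', one_smul]
  refine ⟨t, P, ?_, ⟨fun α hα ↦ hα.1, ?_, ?_⟩, hmem, ?_, ?_⟩
  · constructor
    · have : IsLieAbelian t := ⟨fun x y ↦ by
        ext
        exact hab x y ((hmem _).1 x.2) ((hmem _).1 y.2)⟩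
      infer_instance
    · apply le_antisymm _ (LieSubalgebra.le_normalizer t)
      intro x hx
      rw [LieSubalgebra.mem_normalizer_iff'] at hx
      have h1 := (hmem _).1 (hx H hHt)
      rw [hmem]
      apply hBz
      rw [hinv, h1]
      simp
  · intro α hα
    have h1 := hroot_im α hα
    constructor
    · rintro ⟨-, h⟩ ⟨-, h'⟩
      simp only [LinearMap.neg_apply, Complex.neg_im] at h'
      linarith
    · intro h
      refine ⟨hα, ?_⟩
      by_contra hn
      refine h ⟨hroot_neg α hα, ?_⟩
      simp only [LinearMap.neg_apply, Complex.neg_im]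
      have := lt_of_le_of_ne (not_lt.1 hn) h1
      linarith
  · intro α hα β hβ hαβ
    refine ⟨hαβ, ?_⟩
    simpa using add_pos hα.2 hβ.2
  · intro α hα Z hZ
    obtain ⟨x, y, rfl⟩ := exists_eq_re_add_im Z
    obtain ⟨h1, h2⟩ := (mem_rootSpace_iff t α x y).1 hZ H₀
    rw [hroot_re α hα.1] at h1 h2
    obtain ⟨e1, e2⟩ := hφ' _ hα.2 x y (by rw [h1]; module) (by rw [h2]; module)
    rw [smul_re_add_im]
    simp [e1, e2]
  · intro α hα Z hZ
    obtain ⟨x, y, rfl⟩ := exists_eq_re_add_im Z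
    obtain ⟨h1, h2⟩ := (mem_rootSpace_iff t (-α) x y).1 hZ H₀
    simp only [LinearMap.neg_apply, Complex.neg_re, Complex.neg_im, hroot_re α hα.1] at h1 h2
    obtain ⟨e1, e2⟩ := hφ' _ hα.2 y x (by rw [h2]; module) (by rw [h1]; module)
    rw [smul_re_add_im]
    simp [e1, e2]

/-- The algebraic data of the structure, on a Lie algebra with an invariant inner product. -/
theorem exists_lie_structure [FiniteDimensional ℝ L] (hodd : Odd (finrank ℝ L))
    (hsymm : ∀ x y, B x y = B y x) (hpos : ∀ x, x ≠ 0 → 0 < B x x)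
    (hinv : ∀ x y z : L, B ⁅x, y⁆ z = -B y ⁅x, z⁆) :
    ∃ (ξ : L) (φ : L →ₗ[ℝ] L), B ξ ξ = 1 ∧ φ ξ = 0 ∧ (∀ x, φ (φ x) = -x + B ξ x • ξ) ∧
      (∀ x y, B (φ x) y = -B x (φ y)) ∧
      (∀ x y, ⁅φ x, φ y⁆ - ⁅x, y⁆ - φ ⁅φ x, y⁆ - φ ⁅x, φ y⁆ = 0) ∧
      ∃ (t : LieSubalgebra ℝ L) (P : Set (t →ₗ[ℝ] ℂ)),
        t.IsCartanSubalgebra ∧ IsPositiveSystem t P ∧ ξ ∈ t ∧ (∀ h ∈ t, φ h ∈ t) ∧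
        (∀ α ∈ P, ∀ Z ∈ rootSpace t α, LinearMap.baseChange ℂ φ Z = Complex.I • Z) ∧
        (∀ α ∈ P, ∀ Z ∈ rootSpace t (-α), LinearMap.baseChange ℂ φ Z = -Complex.I • Z) := by
  have hBz : ∀ x, B x x = 0 → x = 0 := fun x hx ↦ by
    by_contra h; exact (hpos x h).ne' hx
  have hnn : ∀ x, 0 ≤ B x x := fun x ↦ by
    by_cases hx : x = 0
    · simp [hx]
    · exact (hpos x hx).le
  let core : InnerProductSpace.Core ℝ L :=
    { inner := fun x y ↦ B x y
      conj_inner_symm := fun x y ↦ by simp [hsymm x y]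
      re_inner_nonneg := fun x ↦ by simpa using hnn x
      add_left := fun x y z ↦ by simp
      smul_left := fun x y r ↦ by simp
      definite := fun x hx ↦ hBz x hx }
  let b : L →ₗ[ℝ] L →ₗ[ℝ] L := LinearMap.mk₂ ℝ (fun x y ↦ ⁅x, y⁆) add_lie
    (fun r x y ↦ smul_lie r x y) lie_add (fun r x y ↦ lie_smul r x y)
  have hb : ∀ x y, b x y = ⁅x, y⁆ := fun x y ↦ rfl
  let : NormedAddCommGroup L := core.toNormedAddCommGroup
  let : InnerProductSpace ℝ L := InnerProductSpace.ofCore core.toCore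
  have hin : ∀ x y : L, inner ℝ x y = B x y := fun _ _ ↦ rfl
  obtain ⟨H, ξ, φ, hab, hHξ, hHφ, hξ, hφξ, hφφ, hφs, hN, hφa⟩ := exists_algebraic_structure
    (V := L) b (fun x y ↦ by rw [hb, hb, lie_skew]) (fun x y z ↦ by simp only [hb]; exact leibniz_lie x y z)
    (fun x y z ↦ by simpa only [hin, hb] using hinv x y z) hodd
  simp only [hb, hin] at hab hHξ hHφ hξ hφφ hφs hN hφa
  obtain ⟨t, P, ht, hP, hmem, h1, h2⟩ := exists_cartan_positive B hsymm hpos hinv H hab φ hφa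
  exact ⟨ξ, φ, hξ, hφξ, hφφ, hφs, hN, t, P, ht, hP, (hmem _).2 hHξ,
    fun h hh ↦ (hmem _).2 (hHφ h ((hmem _).1 hh)), h1, h2⟩

end Roots

section Frame

variable {E : Type*} [NormedAddCommGroup E] [NormedSpace ℝ E]
  {H : Type*} [TopologicalSpace H] (I : ModelWithCorners ℝ E H)
  {G : Type*} [TopologicalSpace G] [ChartedSpace H G]

theorem totalSpace_mk_congr {x y : G} (h : x = y) (v : E) :
    (⟨x, v⟩ : TangentBundle I G) = ⟨y, v⟩ := by subst h; rfl

variable [Group G]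

/-- The derivative of the left translation by `x`, from the tangent space at `1` (which is `E`)
to the tangent space at `x`. -/
def leftFrame (x : G) : E →L[ℝ] TangentSpace I x :=
  letI d : TangentSpace I (1 : G) →L[ℝ] TangentSpace I (x * 1) := mfderiv I I (fun y ↦ x * y) 1
  d

/-- The left Maurer-Cartan form. -/
def mcForm (x : G) : TangentSpace I x →L[ℝ] E :=
  letI d : TangentSpace I x →L[ℝ] TangentSpace I (x⁻¹ * x) := mfderiv I I (fun y ↦ x⁻¹ * y) x
  d

/-- The derivative at `1` of the right translation by `x`. -/
def rightFrame (x : G) : E →L[ℝ] TangentSpace I x :=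
  letI d : TangentSpace I (1 : G) →L[ℝ] TangentSpace I (1 * x) := mfderiv I I (fun y ↦ y * x) 1
  d

/-- The tangent map of the multiplication. -/
def tangentMul (p : TangentBundle I G × TangentBundle I G) : TangentBundle I G :=
  ⟨p.1.1 * p.2.1, (mfderiv I I (fun y ↦ y * p.2.1) p.1.1 p.1.2 : E) +
    (mfderiv I I (fun y ↦ p.1.1 * y) p.2.1 p.2.2 : E)⟩

theorem tangentMul_zero_left (x : G) (v : E) :
    tangentMul I (⟨x, (0 : E)⟩, ⟨1, v⟩) = ⟨x, leftFrame I x v⟩ := by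
  have h : tangentMul I (⟨x, (0 : E)⟩, ⟨1, v⟩) =
      (⟨x * 1, (leftFrame I x v : E)⟩ : TangentBundle I G) := by
    refine congrArg (fun w : E ↦ (⟨x * 1, w⟩ : TangentBundle I G)) ?_
    have : (mfderiv I I (fun y ↦ y * (1 : G)) x : E →L[ℝ] E) 0 = 0 := map_zero _
    exact (congrArg (· + (leftFrame I x v : E)) this).trans (zero_add _)
  exact h.trans (totalSpace_mk_congr I (mul_one x) _)

theorem tangentMul_inv_left (x : G) (v : TangentSpace I x) :
    tangentMul I (⟨x⁻¹, (0 : E)⟩, ⟨x, v⟩) = ⟨1, mcForm I x v⟩ := by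
  have h : tangentMul I (⟨x⁻¹, (0 : E)⟩, ⟨x, v⟩) =
      (⟨x⁻¹ * x, mcForm I x v⟩ : TangentBundle I G) := by
    refine congrArg (fun w : E ↦ (⟨x⁻¹ * x, w⟩ : TangentBundle I G)) ?_
    have : (mfderiv I I (fun y ↦ y * x) x⁻¹ : E →L[ℝ] E) 0 = 0 := map_zero _
    exact (congrArg (· + (mcForm I x v : E)) this).trans (zero_add _)
  exact h.trans (totalSpace_mk_congr I (inv_mul_cancel x) _)

theorem tangentMul_zero_right (x : G) (v : E) :
    tangentMul I (⟨1, v⟩, ⟨x, (0 : E)⟩) = ⟨x, rightFrame I x v⟩ := by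
  have h : tangentMul I (⟨1, v⟩, ⟨x, (0 : E)⟩) =
      (⟨1 * x, (rightFrame I x v : E)⟩ : TangentBundle I G) := by
    refine congrArg (fun w : E ↦ (⟨1 * x, w⟩ : TangentBundle I G)) ?_
    have : (mfderiv I I (fun y ↦ (1 : G) * y) x : E →L[ℝ] E) 0 = 0 := map_zero _
    exact (congrArg ((rightFrame I x v : E) + ·) this).trans (add_zero _)
  exact h.trans (totalSpace_mk_congr I (one_mul x) _)

theorem leftFrame_one (v : E) : leftFrame I (1 : G) v = v := by
  have h : (fun y : G ↦ 1 * y) = id := by ext; simp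
  change (mfderiv I I (fun y : G ↦ 1 * y) 1 : E →L[ℝ] E) v = v
  rw [h, mfderiv_id]; rfl

variable [LieGroup I ∞ G]

theorem mdifferentiableAt_mul_left' (a x : G) : MDifferentiableAt I I (fun y ↦ a * y) x :=
  (contMDiff_mul_left (I := I) (n := ∞) (a := a)).mdifferentiableAt (by simp)

theorem mdifferentiableAt_mul_right' (a x : G) : MDifferentiableAt I I (fun y ↦ y * a) x :=
  (contMDiff_mul_right (I := I) (n := ∞) (a := a)).mdifferentiableAt (by simp)

theorem mfderiv_mul_left_leftFrame (a x : G) (v : E) :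
    mfderiv I I (fun y ↦ a * y) x (leftFrame I x v) = leftFrame I (a * x) v := by
  have h : (fun y ↦ a * x * y) = (fun y ↦ a * y) ∘ fun y ↦ x * y := by
    ext y; simp [mul_assoc]
  have h1 := mfderiv_comp_of_eq (y := x) (x := (1 : G)) (mdifferentiableAt_mul_left' I a x)
    (mdifferentiableAt_mul_left' I x 1) (mul_one x)
  have h2 : mfderiv I I (fun y ↦ a * x * y) (1 : G) =
    mfderiv I I ((fun y ↦ a * y) ∘ fun y ↦ x * y) (1 : G) := by rw [h]
  have h3 : ∀ z, z = x → (mfderiv I I (fun y ↦ a * y) z : E →L[ℝ] E) =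
      mfderiv I I (fun y ↦ a * y) x := by rintro z rfl; rfl
  have h4 := (congrArg (fun f : E →L[ℝ] E ↦ f v) (h2.trans h1)).symm
  exact (congrArg (fun f : E →L[ℝ] E ↦ f (leftFrame I x v)) (h3 _ (mul_one x)).symm).trans h4

@[simp] theorem mcForm_leftFrame (x : G) (v : E) : mcForm I x (leftFrame I x v) = v := by
  have h := mfderiv_mul_left_leftFrame I x⁻¹ x v
  have h2 : ∀ y : G, y = 1 → (leftFrame I y v : E) = v := by
    rintro y rfl
    exact leftFrame_one I v
  exact Eq.trans h (h2 _ (inv_mul_cancel x))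

@[simp] theorem leftFrame_mcForm (x : G) (v : TangentSpace I x) :
    leftFrame I x (mcForm I x v) = v := by
  have h : (id : G → G) = (fun y ↦ x * y) ∘ fun y ↦ x⁻¹ * y := by
    ext y; simp
  have h1 := mfderiv_comp_of_eq (y := 1) (x := x) (mdifferentiableAt_mul_left' I x 1)
    (mdifferentiableAt_mul_left' I x⁻¹ x) (inv_mul_cancel x)
  have h2 : mfderiv I I (id : G → G) x = mfderiv I I ((fun y ↦ x * y) ∘ fun y ↦ x⁻¹ * y) x := by
    rw [← h]
  rw [mfderiv_id] at h2
  have h3 : ∀ z, z = 1 → (mfderiv I I (fun y ↦ x * y) z : E →L[ℝ] E) =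
      mfderiv I I (fun y ↦ x * y) 1 := by rintro z rfl; rfl
  have h4 := (congrArg (fun f : E →L[ℝ] E ↦ f v) (h2.trans h1)).symm
  exact (congrArg (fun f : E →L[ℝ] E ↦ f (mcForm I x v)) (h3 _ (inv_mul_cancel x)).symm).trans h4

theorem mcForm_one (v : E) : mcForm I (1 : G) v = v :=
  (congrArg (mcForm I (1 : G)) (leftFrame_one I v)).symm.trans (mcForm_leftFrame I 1 v)

theorem contMDiff_tangentMul :
    ContMDiff (I.tangent.prod I.tangent) I.tangent ∞ (tangentMul I (G := G)) := by
  have S₂ : ContMDiff (I.tangent.prod I.tangent) (I.prod I).tangent ∞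
    (equivTangentBundleProd I G I G).symm := contMDiff_equivTangentBundleProd_symm
  have S₃ : ContMDiff (I.prod I).tangent I.tangent ∞
      (tangentMap (I.prod I) I (fun p : G × G ↦ p.1 * p.2)) :=
    (contMDiff_mul I ∞).contMDiff_tangentMap le_rfl
  refine (S₃.comp S₂).congr fun p ↦ ?_
  have h := mfderiv_prod_eq_add_apply (I := I) (I' := I) (I'' := I)
    (f := fun p : G × G ↦ p.1 * p.2) (p := (p.1.1, p.2.1)) (v := ((p.1.2, p.2.2) : E × E))
    ((contMDiff_mul I ∞ (G := G)).mdifferentiableAt (by simp))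
  exact congrArg (fun v : E ↦ (⟨p.1.1 * p.2.1, v⟩ : TangentBundle I G)) h.symm

theorem trivializationAt_self_snd (x : G) (v : E) :
    (trivializationAt E (TangentSpace I : G → Type _) x ⟨x, v⟩).2 = v :=
  (tangentBundleCore I G).coordChange_self (achart H x) x (mem_chart_source H x) v

end Frame

section Frame

variable {E : Type*} [NormedAddCommGroup E] [NormedSpace ℝ E]
  {H : Type*} [TopologicalSpace H] {I : ModelWithCorners ℝ E H}
  {G : Type*} [TopologicalSpace G] [ChartedSpace H G] [Group G] [LieGroup I ∞ G]

theorem contMDiffAt_tangent_mk_iff {f : G → E} {a x : G} :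
    ContMDiffAt I I.tangent ∞ (fun y ↦ (⟨a, f y⟩ : TangentBundle I G)) x ↔
      ContMDiffAt I 𝓘(ℝ, E) ∞ f x := by
  rw [contMDiffAt_totalSpace]
  simp only [trivializationAt_self_snd]
  exact and_iff_right contMDiffAt_const

theorem mdifferentiableAt_tangent_mk_iff {f : G → E} {a x : G} :
    MDifferentiableAt I I.tangent (fun y ↦ (⟨a, f y⟩ : TangentBundle I G)) x ↔
      MDifferentiableAt I 𝓘(ℝ, E) f x := by
  rw [mdifferentiableAt_totalSpace]
  simp only [trivializationAt_self_snd]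
  exact and_iff_right mdifferentiableAt_const

theorem contMDiff_zero_tangent :
    ContMDiff I I.tangent ∞ (fun x : G ↦ (⟨x, (0 : E)⟩ : TangentBundle I G)) :=
  contMDiff_zeroSection ℝ (TangentSpace I : G → Type _)

theorem contMDiff_zero_tangent_inv :
    ContMDiff I I.tangent ∞ (fun x : G ↦ (⟨x⁻¹, (0 : E)⟩ : TangentBundle I G)) :=
  contMDiff_zero_tangent.comp (contMDiff_inv I ∞)

theorem contMDiffAt_leftFrame {f : G → E} {x : G} (hf : ContMDiffAt I 𝓘(ℝ, E) ∞ f x) :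
    ContMDiffAt I I.tangent ∞ (fun y ↦ (⟨y, leftFrame I y (f y)⟩ : TangentBundle I G)) x := by
  have h := (contMDiff_tangentMul I (G := G)).contMDiffAt.comp x
    (contMDiff_zero_tangent.contMDiffAt.prodMk (contMDiffAt_tangent_mk_iff (a := 1).2 hf))
  simpa only [Function.comp_def, tangentMul_zero_left] using h

theorem contMDiffAt_mcForm {X : Π x : G, TangentSpace I x} {x : G}
    (hX : ContMDiffAt I I.tangent ∞ (fun y ↦ (⟨y, X y⟩ : TangentBundle I G)) x) :
    ContMDiffAt I 𝓘(ℝ, E) ∞ (fun y ↦ mcForm I y (X y)) x := by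
  have h := (contMDiff_tangentMul I (G := G)).contMDiffAt.comp x
    (contMDiff_zero_tangent_inv.contMDiffAt.prodMk hX)
  simp only [Function.comp_def, tangentMul_inv_left] at h
  exact contMDiffAt_tangent_mk_iff.1 h

theorem mdifferentiableAt_mcForm {X : Π x : G, TangentSpace I x} {x : G}
    (hX : MDifferentiableAt I I.tangent (fun y ↦ (⟨y, X y⟩ : TangentBundle I G)) x) :
    MDifferentiableAt I 𝓘(ℝ, E) (fun y ↦ mcForm I y (X y)) x := by
  have h := ((contMDiff_tangentMul I (G := G)).mdifferentiable (by simp)).mdifferentiableAt.comp x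
    ((contMDiff_zero_tangent_inv.mdifferentiable (by simp)).mdifferentiableAt.prodMk hX)
  simp only [Function.comp_def, tangentMul_inv_left] at h
  exact mdifferentiableAt_tangent_mk_iff.1 h

theorem contMDiff_rightFrame (v : E) :
    ContMDiff I I.tangent ∞ (fun y : G ↦ (⟨y, rightFrame I y v⟩ : TangentBundle I G)) := by
  have h := (contMDiff_tangentMul I (G := G)).comp
    ((contMDiff_const (c := (⟨1, v⟩ : TangentBundle I G))).prodMk
      (contMDiff_zero_tangent (I := I) (G := G)))
  simpa only [Function.comp_def, tangentMul_zero_right] using h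

theorem isSmoothField_leftFrame {f : G → E} (hf : ContMDiff I 𝓘(ℝ, E) ∞ f) :
    IsSmoothField I (fun y ↦ leftFrame I y (f y)) :=
  fun x ↦ contMDiffAt_leftFrame (hf x)

/-- A vector field read in the left-invariant trivialization. -/
def leftCoord (X : Π x : G, TangentSpace I x) (x : G) : E := mcForm I x (X x)

theorem IsSmoothField.leftCoord {X : Π x : G, TangentSpace I x} (hX : IsSmoothField I X) :
    ContMDiff I 𝓘(ℝ, E) ∞ (leftCoord X) :=
  fun x ↦ contMDiffAt_mcForm (hX x)

theorem leftFrame_leftCoord (X : Π x : G, TangentSpace I x) :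
    (fun x ↦ leftFrame I x (leftCoord X x)) = X := by
  ext x; simp [SasakiTorsion.leftCoord]

@[simp] theorem leftCoord_leftFrame (f : G → E) :
    leftCoord (fun x ↦ leftFrame I x (f x)) = f := by
  ext x; simp [SasakiTorsion.leftCoord]

end Frame

section HomBundle

variable {E : Type*} [NormedAddCommGroup E] [NormedSpace ℝ E]
  {H : Type*} [TopologicalSpace H] {I : ModelWithCorners ℝ E H}
  {M : Type*} [TopologicalSpace M] [ChartedSpace H M]
  {F₁ F₂ : Type*} [NormedAddCommGroup F₁] [NormedSpace ℝ F₁] [FiniteDimensional ℝ F₁]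
  [NormedAddCommGroup F₂] [NormedSpace ℝ F₂]

/-- A map into continuous linear maps out of a finite-dimensional space is smooth as soon as its
evaluations are. -/
theorem contMDiffAt_clm_of_apply {A : M → F₁ →L[ℝ] F₂} {x : M}
    (h : ∀ v, ContMDiffAt I 𝓘(ℝ, F₂) ∞ (fun y ↦ A y v) x) :
    ContMDiffAt I 𝓘(ℝ, F₁ →L[ℝ] F₂) ∞ A x := by
  let b := Module.finBasis ℝ F₁
  let c : Fin (Module.finrank ℝ F₁) → F₁ →L[ℝ] ℝ := fun i ↦ (b.coord i).toContinuousLinearMap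
  have hA : A = fun y ↦ ∑ i, ContinuousLinearMap.smulRightL ℝ F₁ F₂ (c i) (A y (b i)) := by
    ext y v
    have h := congrArg (A y) (b.sum_repr v)
    rw [map_sum] at h
    rw [← h]
    simp [c]
  rw [hA]
  refine contMDiffAt_finsetSum fun i _ ↦ ?_
  exact (ContinuousLinearMap.contMDiff _).contMDiffAt.comp x (h (b i))

variable {V₁ V₂ : M → Type*} [TopologicalSpace (TotalSpace F₁ V₁)]
  [∀ x, AddCommGroup (V₁ x)] [∀ x, Module ℝ (V₁ x)] [∀ x, TopologicalSpace (V₁ x)]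
  [FiberBundle F₁ V₁] [VectorBundle ℝ F₁ V₁]
  [TopologicalSpace (TotalSpace F₂ V₂)]
  [∀ x, AddCommGroup (V₂ x)] [∀ x, Module ℝ (V₂ x)] [∀ x, TopologicalSpace (V₂ x)]
  [∀ x, IsTopologicalAddGroup (V₂ x)] [∀ x, ContinuousSMul ℝ (V₂ x)]
  [FiberBundle F₂ V₂] [VectorBundle ℝ F₂ V₂] [ContMDiffVectorBundle ∞ F₁ V₁ I]

/-- A section of a bundle of homomorphisms is smooth as soon as it sends smooth local sections to
smooth local sections. -/
theorem contMDiffAt_hom_of_apply {ψ : Π x : M, V₁ x →L[ℝ] V₂ x} {x : M}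
    (h : ∀ s : Π y : M, V₁ y, ContMDiffAt I (I.prod 𝓘(ℝ, F₁)) ∞ (fun y ↦ TotalSpace.mk' F₁ y (s y)) x →
      ContMDiffAt I (I.prod 𝓘(ℝ, F₂)) ∞ (fun y ↦ TotalSpace.mk' F₂ y (ψ y (s y))) x) :
    ContMDiffAt I (I.prod 𝓘(ℝ, F₁ →L[ℝ] F₂)) ∞
      (fun y ↦ TotalSpace.mk' (F₁ →L[ℝ] F₂) (E := fun y ↦ V₁ y →L[ℝ] V₂ y) y (ψ y)) x := by
  rw [contMDiffAt_hom_bundle]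
  refine ⟨contMDiffAt_id, contMDiffAt_clm_of_apply fun v ↦ ?_⟩
  let e := trivializationAt F₁ V₁ x
  have hx : x ∈ e.baseSet := mem_baseSet_trivializationAt F₁ V₁ x
  have hs : ContMDiffAt I (I.prod 𝓘(ℝ, F₁)) ∞
      (fun y ↦ TotalSpace.mk' F₁ y (e.symm y v)) x := by
    rw [e.contMDiffAt_section_iff hx]
    refine (contMDiffAt_const (c := v)).congr_of_eventuallyEq ?_
    filter_upwards [e.open_baseSet.mem_nhds hx] with y hy
    exact congrArg Prod.snd (e.apply_mk_symm hy v)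
  have h2 := contMDiffAt_section x |>.1 (h _ hs)
  refine h2.congr_of_eventuallyEq ?_
  filter_upwards [e.open_baseSet.mem_nhds hx,
    (trivializationAt F₂ V₂ x).open_baseSet.mem_nhds (mem_baseSet_trivializationAt F₂ V₂ x)]
    with y hy hy'
  rw [ContinuousLinearMap.inCoordinates_eq hy hy']
  simp [e]

end HomBundle

section Calculus

variable {E : Type*} [NormedAddCommGroup E] [NormedSpace ℝ E]
  {H : Type*} [TopologicalSpace H] {I : ModelWithCorners ℝ E H}
  {M : Type*} [TopologicalSpace M] [ChartedSpace H M]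
  {F F' F'' : Type*} [NormedAddCommGroup F] [NormedSpace ℝ F]
  [NormedAddCommGroup F'] [NormedSpace ℝ F'] [NormedAddCommGroup F''] [NormedSpace ℝ F'']

theorem mvfderiv_clm_apply (A : F →L[ℝ] F') {f : M → F} {x : M}
    (hf : MDifferentiableAt I 𝓘(ℝ, F) f x) (v : TangentSpace I x) :
    mvfderiv I (fun y ↦ A (f y)) x v = A (mvfderiv I f x v) := by
  have h := (A.hasFDerivAt (x := f x)).hasMFDerivAt.comp x hf.hasMFDerivAt
  exact congrArg (fun L : E →L[ℝ] F' ↦ L v) h.mfderiv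

theorem hasMFDerivAt_bilin_apply (B : F →L[ℝ] F' →L[ℝ] F'') {f : M → F} {g : M → F'} {x : M}
    (hf : MDifferentiableAt I 𝓘(ℝ, F) f x) (hg : MDifferentiableAt I 𝓘(ℝ, F') g x) :
    HasMFDerivAt I 𝓘(ℝ, F'') (fun y ↦ B (f y) (g y)) x
      (B.precompR E (f x) (mfderiv I 𝓘(ℝ, F') g x : E →L[ℝ] F') +
        B.precompL E (mfderiv I 𝓘(ℝ, F) f x : E →L[ℝ] F) (g x)) := by
  have h := B.hasFDerivWithinAt_of_bilinear hf.hasMFDerivAt.2 hg.hasMFDerivAt.2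
  have hc : ContinuousAt (fun y ↦ B (f y) (g y)) x :=
    (B.continuous.continuousAt.comp hf.continuousAt).clm_apply hg.continuousAt
  refine ⟨hc, ?_⟩
  have e1 : writtenInExtChartAt I 𝓘(ℝ, F) x f (extChartAt I x x) = f x :=
    congrArg f (extChartAt_to_inv x)
  have e2 : writtenInExtChartAt I 𝓘(ℝ, F') x g (extChartAt I x x) = g x :=
    congrArg g (extChartAt_to_inv x)
  rw [e1, e2] at h
  exact h

theorem mvfderiv_bilin_apply (B : F →L[ℝ] F' →L[ℝ] F'') {f : M → F} {g : M → F'} {x : M}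
    (hf : MDifferentiableAt I 𝓘(ℝ, F) f x) (hg : MDifferentiableAt I 𝓘(ℝ, F') g x)
    (v : TangentSpace I x) :
    mvfderiv I (fun y ↦ B (f y) (g y)) x v =
      B (mvfderiv I f x v) (g x) + B (f x) (mvfderiv I g x v) := by
  refine (congrArg (fun L : E →L[ℝ] F'' ↦ L v) (hasMFDerivAt_bilin_apply B hf hg).mfderiv).trans ?_
  exact add_comm _ _

theorem mdifferentiableAt_bilin_apply (B : F →L[ℝ] F' →L[ℝ] F'') {f : M → F} {g : M → F'} {x : M}
    (hf : MDifferentiableAt I 𝓘(ℝ, F) f x) (hg : MDifferentiableAt I 𝓘(ℝ, F') g x) :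
    MDifferentiableAt I 𝓘(ℝ, F'') (fun y ↦ B (f y) (g y)) x :=
  (hasMFDerivAt_bilin_apply B hf hg).mdifferentiableAt

theorem mdifferentiableAt_clm_apply (A : F →L[ℝ] F') {f : M → F} {x : M}
    (hf : MDifferentiableAt I 𝓘(ℝ, F) f x) :
    MDifferentiableAt I 𝓘(ℝ, F') (fun y ↦ A (f y)) x :=
  ((A.hasFDerivAt (x := f x)).hasMFDerivAt.comp x hf.hasMFDerivAt).mdifferentiableAt

variable [IsManifold I ∞ M]

theorem IsSmoothField.mdifferentiableAt {X : Π x : M, TangentSpace I x} (hX : IsSmoothField I X)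
    (x : M) : MDifferentiableAt I I.tangent (fun y ↦ (⟨y, X y⟩ : TangentBundle I M)) x :=
  (ContMDiff.mdifferentiable hX (by simp)).mdifferentiableAt

variable [CompleteSpace E]

theorem mlieBracket_sum_smul_right {ι : Type*} (s : Finset ι) {f : ι → M → ℝ}
    {V : Π x : M, TangentSpace I x} {W : ι → Π x : M, TangentSpace I x} {x : M}
    (hf : ∀ i, MDifferentiableAt I 𝓘(ℝ, ℝ) (f i) x)
    (hW : ∀ i, MDifferentiableAt I I.tangent (fun y ↦ (⟨y, W i y⟩ : TangentBundle I M)) x) :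
    MDifferentiableAt I I.tangent
      (fun y ↦ (⟨y, (∑ i ∈ s, f i • W i) y⟩ : TangentBundle I M)) x ∧
    mlieBracket I V (∑ i ∈ s, f i • W i) x =
      ∑ i ∈ s, (mvfderiv I (f i) x (V x) • W i x + f i x • mlieBracket I V (W i) x) := by
  classical
  induction s using Finset.induction_on with
  | empty =>
    simp only [Finset.sum_empty]
    exact ⟨mdifferentiableAt_zeroSection .., by simp⟩
  | insert i s hi ih =>
    have h1 : MDifferentiableAt I I.tangent
        (fun y ↦ (⟨y, (f i • W i) y⟩ : TangentBundle I M)) x := (hf i).smul_section (hW i)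
    simp only [Finset.sum_insert hi]
    refine ⟨mdifferentiableAt_add_section h1 ih.1, ?_⟩
    rw [mlieBracket_add_right h1 ih.1, ih.2, mlieBracket_smul_right (hf i) (hW i)]

theorem IsSmoothField.mlieBracket {X Y : Π x : M, TangentSpace I x} (hX : IsSmoothField I X)
    (hY : IsSmoothField I Y) : IsSmoothField I (mlieBracket I X Y) := by
  have : IsManifold I (((⊤ : ℕ∞) : ℕ∞ω) + 1) M := ‹IsManifold I ∞ M›
  have : IsManifold I (minSmoothness ℝ 2) M := by
    rw [minSmoothness_of_isRCLikeNormedField]; infer_instance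
  refine ContDiff.mlieBracket_vectorField (n := ⊤) (m := ⊤) hX hY ?_
  rw [minSmoothness_of_isRCLikeNormedField]; exact le_rfl

/-- The Lie bracket of vector fields is the commutator of derivations. -/
theorem mvfderiv_commutator {X Y W : Π x : M, TangentSpace I x} {f : M → ℝ}
    (hX : IsSmoothField I X) (hY : IsSmoothField I Y) (hW : IsSmoothField I W)
    (hf : ContMDiff I 𝓘(ℝ, ℝ) ∞ f) (x : M) (hWx : W x ≠ 0)
    (hXf : MDifferentiableAt I 𝓘(ℝ, ℝ) (fun y ↦ mvfderiv I f y (X y)) x)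
    (hYf : MDifferentiableAt I 𝓘(ℝ, ℝ) (fun y ↦ mvfderiv I f y (Y y)) x) :
    mvfderiv I (fun y ↦ mvfderiv I f y (Y y)) x (X x) -
      mvfderiv I (fun y ↦ mvfderiv I f y (X y)) x (Y x) = mvfderiv I f x (mlieBracket I X Y x) := by
  have hd := @IsSmoothField.mdifferentiableAt E _ _ H _ I M _ _ _
  have hfd : ∀ y, MDifferentiableAt I 𝓘(ℝ, ℝ) f y :=
    fun y ↦ (hf.mdifferentiable (by simp)).mdifferentiableAt
  have i3 : IsManifold I (minSmoothness ℝ 3) M := by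
    rw [minSmoothness_of_isRCLikeNormedField]; infer_instance
  have h2 : minSmoothness ℝ 2 ≤ ∞ := by
    rw [minSmoothness_of_isRCLikeNormedField]; exact ENat.LEInfty.out
  have hfW : IsSmoothField I (f • W) := hf.smul_section hW
  have hexp : ∀ Z : Π x : M, TangentSpace I x, mlieBracket I Z (f • W) =
      (fun y ↦ mvfderiv I f y (Z y)) • W + f • mlieBracket I Z W := by
    intro Z; ext y
    exact mlieBracket_smul_right (hfd y) (hd hW y)
  have key := leibniz_identity_mlieBracket_apply (I := I) (U := X) (V := Y) (W := f • W) (x := x)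
    ((hX.of_le h2).contMDiffAt) ((hY.of_le h2).contMDiffAt)
    ((hfW.of_le h2).contMDiffAt)
  have key2 := leibniz_identity_mlieBracket_apply (I := I) (U := X) (V := Y) (W := W) (x := x)
    ((hX.of_le h2).contMDiffAt) ((hY.of_le h2).contMDiffAt)
    ((hW.of_le h2).contMDiffAt)
  have e1 : mlieBracket I X (mlieBracket I Y (f • W)) x =
      mvfderiv I (fun y ↦ mvfderiv I f y (Y y)) x (X x) • W x +
      mvfderiv I f x (Y x) • mlieBracket I X W x +
      (mvfderiv I f x (X x) • mlieBracket I Y W x +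
      f x • mlieBracket I X (mlieBracket I Y W) x) := by
    rw [hexp Y, mlieBracket_add_right (hYf.smul_section (hd hW x))
      ((hfd x).smul_section (hd (hY.mlieBracket hW) x)), mlieBracket_smul_right hYf (hd hW x),
      mlieBracket_smul_right (hfd x) (hd (hY.mlieBracket hW) x)]
  have e2 : mlieBracket I Y (mlieBracket I X (f • W)) x =
      mvfderiv I (fun y ↦ mvfderiv I f y (X y)) x (Y x) • W x +
      mvfderiv I f x (X x) • mlieBracket I Y W x +
      (mvfderiv I f x (Y x) • mlieBracket I X W x +
      f x • mlieBracket I Y (mlieBracket I X W) x) := by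
    rw [hexp X, mlieBracket_add_right (hXf.smul_section (hd hW x))
      ((hfd x).smul_section (hd (hX.mlieBracket hW) x)), mlieBracket_smul_right hXf (hd hW x),
      mlieBracket_smul_right (hfd x) (hd (hX.mlieBracket hW) x)]
  rw [e1, e2, mlieBracket_smul_right (hfd x) (hd hW x), key2] at key
  have h0 : (mvfderiv I (fun y ↦ mvfderiv I f y (Y y)) x (X x) -
      mvfderiv I (fun y ↦ mvfderiv I f y (X y)) x (Y x) -
      mvfderiv I f x (mlieBracket I X Y x)) • W x = 0 := by
    rw [← sub_eq_zero] at key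
    rw [← key]
    module
  exact sub_eq_zero.1 ((smul_eq_zero.1 h0).resolve_right hWx)

end Calculus

section FrameConst

variable {E : Type*} [NormedAddCommGroup E] [NormedSpace ℝ E]
  {H : Type*} [TopologicalSpace H] {I : ModelWithCorners ℝ E H}
  {G : Type*} [TopologicalSpace G] [ChartedSpace H G] [Group G] [LieGroup I ∞ G]

theorem isSmoothField_leftFrame_const (v : E) : IsSmoothField I (fun y : G ↦ leftFrame I y v) :=
  isSmoothField_leftFrame contMDiff_const

end FrameConst

section GroupCalculus

variable {E : Type*} [NormedAddCommGroup E] [NormedSpace ℝ E] [FiniteDimensional ℝ E]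
  {H : Type*} [TopologicalSpace H] (I : ModelWithCorners ℝ E H)
  (G : Type*) [TopologicalSpace G] [ChartedSpace H G] [Group G] [LieGroup I ∞ G]

/-- The bracket of the Lie algebra of `G`, as a continuous bilinear map on the model space. -/
def lieBilin : E →L[ℝ] E →L[ℝ] E :=
  letI m : GroupLieAlgebra I G →ₗ[ℝ] GroupLieAlgebra I G →ₗ[ℝ] GroupLieAlgebra I G :=
    LinearMap.mk₂ ℝ (fun x y ↦ ⁅x, y⁆) add_lie (fun r x y ↦ smul_lie r x y) lie_add
      (fun r x y ↦ lie_smul r x y)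
  letI m' : E →ₗ[ℝ] E →ₗ[ℝ] E := m
  LinearMap.toContinuousLinearMap ((LinearMap.toContinuousLinearMap :
    (E →ₗ[ℝ] E) ≃ₗ[ℝ] E →L[ℝ] E).toLinearMap ∘ₗ m')

variable {I G}

theorem lieBilin_skew (u v : E) : lieBilin I G u v = -lieBilin I G v u :=
  (lie_skew (L := GroupLieAlgebra I G) u v).symm

theorem lieBilin_jacobi (u v w : E) : lieBilin I G u (lieBilin I G v w) =
    lieBilin I G (lieBilin I G u v) w + lieBilin I G v (lieBilin I G u w) := by
  have h : ∀ a b c : GroupLieAlgebra I G, ⁅a, ⁅b, c⁆⁆ = ⁅⁅a, b⁆, c⁆ + ⁅b, ⁅a, c⁆⁆ := leibniz_lie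
  exact h u v w

theorem mlieBracket_leftFrame_const (u v : E) (x : G) :
    mlieBracket I (fun y : G ↦ leftFrame I y u) (fun y ↦ leftFrame I y v) x =
      leftFrame I x (lieBilin I G u v) :=
  (congrFun (mulInvariantVector_mlieBracket (I := I) (G := G) u v) x).symm

theorem mlieBracket_eq_sum (V : Π x : G, TangentSpace I x) {Y : Π x : G, TangentSpace I x} {x : G}
    (hY : MDifferentiableAt I I.tangent (fun y ↦ (⟨y, Y y⟩ : TangentBundle I G)) x) :
    mlieBracket I V Y x = leftFrame I x (mvfderiv I (leftCoord Y) x (V x)) +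
      ∑ i, (Module.finBasis ℝ E).repr (leftCoord Y x) i •
        mlieBracket I V (fun y ↦ leftFrame I y (Module.finBasis ℝ E i)) x := by
  set b := Module.finBasis ℝ E
  let c : Fin (Module.finrank ℝ E) → E →L[ℝ] ℝ := fun i ↦ (b.coord i).toContinuousLinearMap
  have hfY : MDifferentiableAt I 𝓘(ℝ, E) (leftCoord Y) x := mdifferentiableAt_mcForm hY
  have hYs : Y = ∑ i, (fun y ↦ c i (leftCoord Y y)) • fun y ↦ leftFrame I y (b i) := by
    ext y
    rw [Finset.sum_apply]
    have h := congrArg (leftFrame I y) (b.sum_repr (leftCoord Y y))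
    rw [map_sum] at h
    conv_lhs => rw [← leftFrame_leftCoord Y]
    change leftFrame I y (leftCoord Y y) = _
    rw [← h]
    simp [c]
  have key := (mlieBracket_sum_smul_right Finset.univ (V := V) (x := x)
    (f := fun i y ↦ c i (leftCoord Y y)) (W := fun i y ↦ leftFrame I y (b i))
    (fun i ↦ mdifferentiableAt_clm_apply (c i) hfY)
    (fun i ↦ (isSmoothField_leftFrame_const (b i)).mdifferentiableAt x)).2
  rw [← hYs, Finset.sum_add_distrib] at key
  rw [key]
  congr 1
  have h := congrArg (leftFrame I x) (b.sum_repr (mvfderiv I (leftCoord Y) x (V x)))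
  rw [map_sum] at h
  rw [← h]
  refine Finset.sum_congr rfl fun i _ ↦ ?_
  rw [mvfderiv_clm_apply (c i) hfY]
  simp [c]

/-- The Lie bracket of vector fields in the left-invariant trivialization. -/
theorem mlieBracket_eq_leftFrame {X Y : Π x : G, TangentSpace I x} {x : G}
    (hX : MDifferentiableAt I I.tangent (fun y ↦ (⟨y, X y⟩ : TangentBundle I G)) x)
    (hY : MDifferentiableAt I I.tangent (fun y ↦ (⟨y, Y y⟩ : TangentBundle I G)) x) :
    mlieBracket I X Y x = leftFrame I x (mvfderiv I (leftCoord Y) x (X x) -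
      mvfderiv I (leftCoord X) x (Y x) + lieBilin I G (leftCoord X x) (leftCoord Y x)) := by
  set b := Module.finBasis ℝ E
  have h1 : ∀ w : E, mlieBracket I (fun y ↦ leftFrame I y w) X x =
      leftFrame I x (mvfderiv I (leftCoord X) x (leftFrame I x w) +
        lieBilin I G w (leftCoord X x)) := by
    intro w
    rw [mlieBracket_eq_sum _ hX, map_add]
    congr 1
    simp only [mlieBracket_leftFrame_const]
    have h := congrArg (fun v ↦ leftFrame I x (lieBilin I G w v)) (b.sum_repr (leftCoord X x))
    simp only [map_sum, map_smul] at h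
    exact h
  rw [mlieBracket_eq_sum _ hY, sub_add, map_sub, sub_eq_add_neg]
  congr 1
  have h2 : ∀ w : E, mlieBracket I X (fun y ↦ leftFrame I y w) x =
      -leftFrame I x (mvfderiv I (leftCoord X) x (leftFrame I x w) +
        lieBilin I G w (leftCoord X x)) := by
    intro w
    rw [mlieBracket_swap_apply, h1]
  simp only [h2]
  have h := congrArg (fun v ↦ -leftFrame I x (mvfderiv I (leftCoord X) x (leftFrame I x v) +
        lieBilin I G v (leftCoord X x))) (b.sum_repr (leftCoord Y x))
  have hskew : lieBilin I G (leftCoord Y x) (leftCoord X x) =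
      -lieBilin I G (leftCoord X x) (leftCoord Y x) := lieBilin_skew _ _
  rw [hskew] at h
  have h3 : leftFrame I x (leftCoord Y x) = Y x := congrFun (leftFrame_leftCoord Y) x
  rw [h3, ← sub_eq_add_neg] at h
  rw [← h]
  simp only [map_add, map_sum, map_smul, sum_apply,
    smul_apply, ← Finset.sum_add_distrib, ← Finset.sum_neg_distrib]
  refine Finset.sum_congr rfl fun i _ ↦ ?_
  module

theorem leftCoord_mlieBracket {X Y : Π x : G, TangentSpace I x} {x : G}
    (hX : MDifferentiableAt I I.tangent (fun y ↦ (⟨y, X y⟩ : TangentBundle I G)) x)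
    (hY : MDifferentiableAt I I.tangent (fun y ↦ (⟨y, Y y⟩ : TangentBundle I G)) x) :
    leftCoord (mlieBracket I X Y) x = mvfderiv I (leftCoord Y) x (X x) -
      mvfderiv I (leftCoord X) x (Y x) + lieBilin I G (leftCoord X x) (leftCoord Y x) := by
  rw [leftCoord, mlieBracket_eq_leftFrame hX hY, mcForm_leftFrame]

end GroupCalculus

section Commute

variable {E : Type*} [NormedAddCommGroup E] [NormedSpace ℝ E]

/-- The two partial derivatives of a function of two variables that has its first variable as
left unit and second variable as right unit give commuting vector fields. -/
theorem lieBracket_partial_eq_zero {μ : E × E → E} {c : E} (hμ : ContDiffAt ℝ ∞ μ (c, c))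
    (w u : E) (hw : fderiv ℝ μ (c, c) (0, w) = w) (hu : fderiv ℝ μ (c, c) (u, 0) = u) :
    lieBracket ℝ (fun a ↦ fderiv ℝ μ (a, c) (0, w)) (fun a ↦ fderiv ℝ μ (c, a) (u, 0)) c = 0 := by
  have h2 : minSmoothness ℝ 2 ≤ ∞ := by
    rw [minSmoothness_of_isRCLikeNormedField]; exact ENat.LEInfty.out
  have hsymm := hμ.isSymmSndFDerivAt h2
  have hd : DifferentiableAt ℝ (fderiv ℝ μ) (c, c) :=
    (hμ.fderiv_right (m := 1) (by norm_num; exact ENat.LEInfty.out)).differentiableAt (by simp)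
  have h1 : HasFDerivAt (fun a : E ↦ fderiv ℝ μ (a, c) (0, w))
      (((ContinuousLinearMap.apply ℝ E ((0 : E), w)).comp (fderiv ℝ (fderiv ℝ μ) (c, c))).comp
        (ContinuousLinearMap.inl ℝ E E)) c :=
    ((ContinuousLinearMap.apply ℝ E ((0 : E), w)).hasFDerivAt.comp (c, c) hd.hasFDerivAt).comp c
      (f := fun a : E ↦ (a, c)) (hasFDerivAt_prodMk_left c c)
  have h1' : HasFDerivAt (fun a : E ↦ fderiv ℝ μ (c, a) (u, 0))
      (((ContinuousLinearMap.apply ℝ E (u, (0 : E))).comp (fderiv ℝ (fderiv ℝ μ) (c, c))).comp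
        (ContinuousLinearMap.inr ℝ E E)) c :=
    ((ContinuousLinearMap.apply ℝ E (u, (0 : E))).hasFDerivAt.comp (c, c) hd.hasFDerivAt).comp c
      (f := fun a : E ↦ (c, a)) (hasFDerivAt_prodMk_right c c)
  rw [lieBracket_eq]
  beta_reduce
  rw [h1.fderiv, h1'.fderiv]
  simp only [ContinuousLinearMap.comp_apply, ContinuousLinearMap.apply_apply,
    ContinuousLinearMap.inl_apply, ContinuousLinearMap.inr_apply, hw, hu]
  rw [hsymm (0, w) (u, 0), sub_self]

variable {H : Type*} [TopologicalSpace H] {I : ModelWithCorners ℝ E H}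
  {G : Type*} [TopologicalSpace G] [ChartedSpace H G]

theorem HasMFDerivAt.comp₃_hasFDerivAt {f : E → G} {g : G → G} {h : G → E} {a : E} {y z : G}
    {f' g' h' : E →L[ℝ] E} (hf : HasMFDerivAt 𝓘(ℝ, E) I f a f') (hfa : f a = y)
    (hg : HasMFDerivAt I I g y g') (hgy : g y = z) (hh : HasMFDerivAt I 𝓘(ℝ, E) h z h') :
    HasFDerivAt (fun b ↦ h (g (f b))) (h'.comp (g'.comp f')) a := by
  subst hfa hgy
  exact (HasMFDerivAt.comp (f := fun b ↦ g (f b)) a hh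
    (HasMFDerivAt.comp (f := f) a hg hf)).hasFDerivAt

variable [I.Boundaryless] [Group G] [LieGroup I ∞ G]

/-- Left-invariant and right-invariant vector fields commute. -/
theorem mlieBracket_leftFrame_rightFrame [CompleteSpace E] (w u : E) :
    mlieBracket I (fun y : G ↦ leftFrame I y w) (fun y ↦ rightFrame I y u) 1 = 0 := by
  set φ := extChartAt I (1 : G) with hφ
  set c := φ 1 with hc
  have hct : c ∈ φ.target := mem_extChartAt_target 1
  have hc1 : φ.symm c = 1 := extChartAt_to_inv 1
  have htn : φ.target ∈ nhds c := extChartAt_target_mem_nhds 1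
  have hopen : IsOpen φ.target := isOpen_extChartAt_target 1
  let μ : E × E → E := fun p ↦ φ (φ.symm p.1 * φ.symm p.2)
  have hsymm : ∀ a ∈ φ.target, ContMDiffAt 𝓘(ℝ, E) I ∞ φ.symm a := fun a ha ↦
    (contMDiffOn_extChartAt_symm (1 : G)).contMDiffAt (hopen.mem_nhds ha)
  have hμs : ∀ a ∈ φ.target, ∀ b ∈ φ.target, φ.symm a * φ.symm b ∈ φ.source →
      ContDiffAt ℝ ∞ μ (a, b) := by
    intro a ha b hb hab
    rw [← contMDiffAt_iff_contDiffAt]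
    have h1 : ContMDiffAt 𝓘(ℝ, E × E) I ∞ (fun p : E × E ↦ φ.symm p.1 * φ.symm p.2) (a, b) := by
      have h := (ContMDiffAt.comp (f := Prod.fst) (a, b) (hsymm a ha) contMDiffAt_fst).mul
        (ContMDiffAt.comp (f := Prod.snd) (a, b) (hsymm b hb) contMDiffAt_snd)
      rw [modelWithCornersSelf_prod, ← chartedSpaceSelf_prod]
      exact h
    have h2 : ContMDiffAt I 𝓘(ℝ, E) ∞ φ (φ.symm a * φ.symm b) :=
      contMDiffAt_extChartAt' (by simpa [hφ] using hab)
    exact ContMDiffAt.comp (a, b) h2 h1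
  have hmap : ∀ a ∈ φ.target, φ.symm a ∈ φ.source := fun a ha ↦ φ.map_target ha
  have hφd : ∀ a ∈ φ.target, HasMFDerivAt I 𝓘(ℝ, E) φ (φ.symm a)
      (mfderiv I 𝓘(ℝ, E) φ (φ.symm a) : E →L[ℝ] E) := fun a ha ↦
    ((contMDiffAt_extChartAt' (n := ∞) (by simpa [hφ] using hmap a ha)).mdifferentiableAt
      (by simp)).hasMFDerivAt
  have hsd : HasMFDerivAt 𝓘(ℝ, E) I φ.symm c (ContinuousLinearMap.id ℝ E) := by
    have h1 := ((hsymm c hct).mdifferentiableAt (by simp)).hasMFDerivAt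
    have h2 := mfderivWithin_range_extChartAt_symm (I := I) (x := (1 : G))
    rw [I.range_eq_univ, mfderivWithin_univ] at h2
    have h3 : (mfderiv 𝓘(ℝ, E) I φ.symm c : E →L[ℝ] E) = ContinuousLinearMap.id ℝ E := h2
    rw [← h3]
    exact h1
  have hpull : ∀ a ∈ φ.target, ∀ V : Π y : G, TangentSpace I y,
      mpullbackWithin 𝓘(ℝ, E) I φ.symm V (Set.range I) a =
        (mfderiv I 𝓘(ℝ, E) φ (φ.symm a) : E →L[ℝ] E) (V (φ.symm a)) := by
    intro a ha V
    have h := ContinuousLinearMap.inverse_eq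
      (mfderivWithin_extChartAt_symm_comp_mfderiv_extChartAt (I := I) (x := (1 : G)) ha)
      (mfderiv_extChartAt_comp_mfderivWithin_extChartAt_symm ha)
    rw [mpullbackWithin_apply]
    exact congrArg (fun L : E →L[ℝ] E ↦ L (V (φ.symm a))) h
  have hmul1 : ∀ a ∈ φ.target, φ.symm a * φ.symm c ∈ φ.source := by
    intro a ha; rw [hc1, mul_one]; exact hmap a ha
  have hmul2 : ∀ a ∈ φ.target, φ.symm c * φ.symm a ∈ φ.source := by
    intro a ha; rw [hc1, one_mul]; exact hmap a ha
  have hL : ∀ a ∈ φ.target, HasFDerivAt (fun b ↦ μ (a, b))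
      ((fderiv ℝ μ (a, c)).comp (ContinuousLinearMap.inr ℝ E E)) c := fun a ha ↦
    HasFDerivAt.comp (f := fun b : E ↦ (a, b)) c
      ((hμs a ha c hct (hmul1 a ha)).differentiableAt (by simp)).hasFDerivAt
      (hasFDerivAt_prodMk_right a c)
  have hR : ∀ a ∈ φ.target, HasFDerivAt (fun b ↦ μ (b, a))
      ((fderiv ℝ μ (c, a)).comp (ContinuousLinearMap.inl ℝ E E)) c := fun a ha ↦
    HasFDerivAt.comp (f := fun b : E ↦ (b, a)) c
      ((hμs c hct a ha (hmul2 a ha)).differentiableAt (by simp)).hasFDerivAt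
      (hasFDerivAt_prodMk_left c a)
  have hLw : ∀ a ∈ φ.target, mpullbackWithin 𝓘(ℝ, E) I φ.symm (fun y : G ↦ leftFrame I y w)
      (Set.range I) a = fderiv ℝ μ (a, c) (0, w) := by
    intro a ha
    rw [hpull a ha]
    have h := HasMFDerivAt.comp₃_hasFDerivAt hsd hc1
      ((mdifferentiableAt_mul_left' I (φ.symm a) 1).hasMFDerivAt) (mul_one _) (hφd a ha)
    exact congrArg (fun L : E →L[ℝ] E ↦ L w) (h.unique (hL a ha))
  have hRu : ∀ a ∈ φ.target, mpullbackWithin 𝓘(ℝ, E) I φ.symm (fun y : G ↦ rightFrame I y u)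
      (Set.range I) a = fderiv ℝ μ (c, a) (u, 0) := by
    intro a ha
    rw [hpull a ha]
    have h := HasMFDerivAt.comp₃_hasFDerivAt hsd hc1
      ((mdifferentiableAt_mul_right' I (φ.symm a) 1).hasMFDerivAt) (one_mul _) (hφd a ha)
    exact congrArg (fun L : E →L[ℝ] E ↦ L u) (h.unique (hR a ha))
  have hw : fderiv ℝ μ (c, c) (0, w) = w := by
    have h : HasFDerivAt (fun b ↦ μ (c, b)) (ContinuousLinearMap.id ℝ E) c := by
      refine (hasFDerivAt_id c).congr_of_eventuallyEq ?_
      filter_upwards [htn] with b hb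
      simp only [μ, hc1, one_mul]
      exact φ.right_inv hb
    exact congrArg (fun L : E →L[ℝ] E ↦ L w) ((hL c hct).unique h)
  have hu : fderiv ℝ μ (c, c) (u, 0) = u := by
    have h : HasFDerivAt (fun b ↦ μ (b, c)) (ContinuousLinearMap.id ℝ E) c := by
      refine (hasFDerivAt_id c).congr_of_eventuallyEq ?_
      filter_upwards [htn] with b hb
      simp only [μ, hc1, mul_one]
      exact φ.right_inv hb
    exact congrArg (fun L : E →L[ℝ] E ↦ L u) ((hR c hct).unique h)
  have hzero := lieBracket_partial_eq_zero (hμs c hct c hct (hmul1 c hct)) w u hw hu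
  rw [← mlieBracketWithin_univ, mlieBracketWithin_apply, Set.preimage_univ, Set.univ_inter,
    I.range_eq_univ]
  rw [I.range_eq_univ] at hLw hRu
  have hcong := Filter.EventuallyEq.lieBracketWithin_vectorField_eq_nhds (𝕜 := ℝ) (s := Set.univ)
    (Filter.mem_of_superset htn hLw) (Filter.mem_of_superset htn hRu)
  rw [← lieBracketWithin_univ] at hzero
  exact (congrArg (fun v : E ↦ (mfderiv I 𝓘(ℝ, E) φ (1 : G) : E →L[ℝ] E).inverse v)
    (hcong.trans hzero)).trans (map_zero _)

end Commute

section Averaging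

open MeasureTheory

variable {E : Type*} [NormedAddCommGroup E] [NormedSpace ℝ E] [FiniteDimensional ℝ E]
  {G : Type*} [TopologicalSpace G] [Group G] [IsTopologicalGroup G] [CompactSpace G]

/-- A linear (right) action of a compact group preserves a scalar product. -/
theorem exists_invariant_scalarProduct (A : G → E →L[ℝ] E)
    (hA : ∀ u, Continuous fun x ↦ A x u) (hmul : ∀ x a u, A (x * a) u = A a (A x u))
    (hone : ∀ u, A 1 u = u) :
    ∃ B : E →L[ℝ] E →L[ℝ] ℝ, (∀ u v, B u v = B v u) ∧ (∀ u, u ≠ 0 → 0 < B u u) ∧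
      ∀ a u v, B (A a u) (A a v) = B u v := by
  let _ : MeasurableSpace G := borel G
  have : BorelSpace G := ⟨rfl⟩
  let ip : E → E → G → ℝ := fun u v x ↦ inner ℝ (toEuclidean (A x u)) (toEuclidean (A x v))
  have hc : ∀ u v, Continuous (ip u v) := fun u v ↦
    (toEuclidean.continuous.comp (hA u)).inner (toEuclidean.continuous.comp (hA v))
  have hi : ∀ u v, Integrable (ip u v) Measure.haar := fun u v ↦
    (hc u v).integrable_of_hasCompactSupport (HasCompactSupport.of_compactSpace _)
  let B₀ : E →ₗ[ℝ] E →ₗ[ℝ] ℝ := LinearMap.mk₂ ℝ (fun u v ↦ ∫ x, ip u v x ∂Measure.haar)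
    (fun u u' v ↦ by
      rw [← integral_add (hi _ _) (hi _ _)]
      exact integral_congr_ae (.of_forall fun x ↦ by simp [ip, inner_add_left]))
    (fun r u v ↦ by
      rw [smul_eq_mul, ← integral_const_mul]
      exact integral_congr_ae (.of_forall fun x ↦ by simp [ip, real_inner_smul_left]))
    (fun u v v' ↦ by
      rw [← integral_add (hi _ _) (hi _ _)]
      exact integral_congr_ae (.of_forall fun x ↦ by simp [ip, inner_add_right]))
    (fun r u v ↦ by
      rw [smul_eq_mul, ← integral_const_mul]
      exact integral_congr_ae (.of_forall fun x ↦ by simp [ip, real_inner_smul_right]))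
  refine ⟨LinearMap.toContinuousLinearMap ((LinearMap.toContinuousLinearMap :
    (E →ₗ[ℝ] ℝ) ≃ₗ[ℝ] E →L[ℝ] ℝ).toLinearMap ∘ₗ B₀), ?_, ?_, ?_⟩
  · intro u v
    exact integral_congr_ae (.of_forall fun x ↦ real_inner_comm _ _)
  · intro u hu
    refine (hc u u).integral_pos_of_hasCompactSupport_nonneg_nonzero
      (HasCompactSupport.of_compactSpace _) (fun x ↦ real_inner_self_nonneg) (x := 1) ?_
    simpa [ip, hone] using hu
  · intro a u v
    have h := integral_mul_left_eq_self (μ := (Measure.haar : Measure G)) (ip u v) a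
    refine Eq.trans (integral_congr_ae (.of_forall fun x ↦ ?_)) h
    simp [ip, hmul]

end Averaging

section Adjoint

variable {E : Type*} [NormedAddCommGroup E] [NormedSpace ℝ E]
  {H : Type*} [TopologicalSpace H] (I : ModelWithCorners ℝ E H)
  {G : Type*} [TopologicalSpace G] [ChartedSpace H G] [Group G]

/-- The adjoint action of `x⁻¹` on the Lie algebra. -/
def adInv (x : G) : E →L[ℝ] E := (mcForm I x).comp (rightFrame I x)

variable [LieGroup I ∞ G]

theorem contMDiff_adInv (u : E) : ContMDiff I 𝓘(ℝ, E) ∞ fun x : G ↦ adInv I x u :=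
  fun x ↦ contMDiffAt_mcForm ((contMDiff_rightFrame u) x)

theorem leftFrame_adInv (x : G) (u : E) : leftFrame I x (adInv I x u) = rightFrame I x u :=
  leftFrame_mcForm I x _

theorem adInv_one (u : E) : adInv I (1 : G) u = u := by
  have h : rightFrame I (1 : G) u = leftFrame I 1 u := by
    have h1 : (fun y : G ↦ y * 1) = fun y ↦ 1 * y := by ext; simp
    exact congrArg (fun f : G → G ↦ (mfderiv I I f 1 : E →L[ℝ] E) u) h1
  rw [adInv, ContinuousLinearMap.comp_apply, h, mcForm_leftFrame]

theorem mfderiv_mul_right_leftFrame (a x : G) (v : E) :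
    mfderiv I I (fun y ↦ y * a) x (leftFrame I x v) = leftFrame I (x * a) (adInv I a v) := by
  have h1 := mfderiv_comp_of_eq (y := x) (x := (1 : G)) (mdifferentiableAt_mul_right' I a x)
    (mdifferentiableAt_mul_left' I x 1) (mul_one x)
  have h2 := mfderiv_comp_of_eq (y := a) (x := (1 : G)) (mdifferentiableAt_mul_left' I x a)
    (mdifferentiableAt_mul_right' I a 1) (one_mul a)
  have h : (fun y ↦ y * a) ∘ (fun y ↦ x * y) = (fun y ↦ x * y) ∘ fun y ↦ y * a := by
    ext y; simp [mul_assoc]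
  have h3 : (mfderiv I I ((fun y ↦ y * a) ∘ fun y ↦ x * y) (1 : G) : E →L[ℝ] E) =
      mfderiv I I ((fun y ↦ x * y) ∘ fun y ↦ y * a) (1 : G) := by rw [h]
  have h5 : ∀ z, z = x → (mfderiv I I (fun y ↦ y * a) z : E →L[ℝ] E) =
      mfderiv I I (fun y ↦ y * a) x := by rintro z rfl; rfl
  have h6 : ∀ z, z = a → (mfderiv I I (fun y ↦ x * y) z : E →L[ℝ] E) =
      mfderiv I I (fun y ↦ x * y) a := by rintro z rfl; rfl
  have h4 := congrArg (fun f : E →L[ℝ] E ↦ f v) (h1.symm.trans (h3.trans h2))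
  have h7 : (mfderiv I I (fun y ↦ y * a) x : E →L[ℝ] E) (leftFrame I x v) =
      (mfderiv I I (fun y ↦ x * y) a : E →L[ℝ] E) (rightFrame I a v) :=
    (congrArg (fun f : E →L[ℝ] E ↦ f (leftFrame I x v)) (h5 _ (mul_one x)).symm).trans
      (h4.trans (congrArg (fun f : E →L[ℝ] E ↦ f (rightFrame I a v)) (h6 _ (one_mul a))))
  refine Eq.trans h7 ?_
  rw [← leftFrame_adInv]
  exact mfderiv_mul_left_leftFrame I x a _

theorem adInv_mul (x a : G) (u : E) : adInv I (x * a) u = adInv I a (adInv I x u) := by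
  have h1 := mfderiv_comp_of_eq (y := x) (x := (1 : G)) (mdifferentiableAt_mul_right' I a x)
    (mdifferentiableAt_mul_right' I x 1) (one_mul x)
  have h : (fun y ↦ y * a) ∘ (fun y ↦ y * x) = fun y ↦ y * (x * a) := by
    ext y; simp [mul_assoc]
  rw [h] at h1
  have h5 : ∀ z, z = x → (mfderiv I I (fun y ↦ y * a) z : E →L[ℝ] E) =
      mfderiv I I (fun y ↦ y * a) x := by rintro z rfl; rfl
  have h4 := congrArg (fun f : E →L[ℝ] E ↦ f u) h1
  have h7 : rightFrame I (x * a) u = mfderiv I I (fun y ↦ y * a) x (rightFrame I x u) :=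
    h4.trans (congrArg (fun f : E →L[ℝ] E ↦ f (rightFrame I x u)) (h5 _ (one_mul x)))
  rw [adInv, ContinuousLinearMap.comp_apply, h7, ← leftFrame_adInv, mfderiv_mul_right_leftFrame,
    mcForm_leftFrame]

variable [FiniteDimensional ℝ E] [I.Boundaryless]

/-- The derivative of the adjoint action is the bracket. -/
theorem mvfderiv_adInv (w u : E) :
    mvfderiv I (fun x : G ↦ adInv I x u) 1 (leftFrame I 1 w) = -lieBilin I G w u := by
  have h := leftCoord_mlieBracket (I := I) (x := (1 : G))
    ((isSmoothField_leftFrame_const w).mdifferentiableAt 1)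
    (((contMDiff_rightFrame u).mdifferentiable (by simp)).mdifferentiableAt)
  rw [leftCoord, mlieBracket_leftFrame_rightFrame, map_zero, leftCoord_leftFrame (fun _ ↦ w)] at h
  have h0 : mvfderiv I (fun _ : G ↦ w) 1 (rightFrame I 1 u) = 0 := by
    rw [mvfderiv_const]; rfl
  have h1 : leftCoord (fun y ↦ rightFrame I y u) (1 : G) = u := adInv_one I u
  rw [h0, sub_zero, h1] at h
  exact eq_neg_of_add_eq_zero_left h.symm

/-- A scalar product invariant under the adjoint action has skew-symmetric brackets. -/
theorem lieBilin_skew_of_adInv (B : E →L[ℝ] E →L[ℝ] ℝ)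
    (hB : ∀ (a : G) u v, B (adInv I a u) (adInv I a v) = B u v) (w u v : E) :
    B (lieBilin I G w u) v = -B u (lieBilin I G w v) := by
  have hd : ∀ u, MDifferentiableAt I 𝓘(ℝ, E) (fun x : G ↦ adInv I x u) 1 := fun u ↦
    ((contMDiff_adInv I u).mdifferentiable (by simp)).mdifferentiableAt
  have h := mvfderiv_bilin_apply B (hd u) (hd v) (leftFrame I 1 w)
  have h0 : mvfderiv I (fun x : G ↦ B (adInv I x u) (adInv I x v)) 1 (leftFrame I 1 w) = 0 := by
    simp only [hB]
    rw [mvfderiv_const]; rfl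
  rw [h0, mvfderiv_adInv, mvfderiv_adInv, adInv_one, adInv_one, map_neg, map_neg,
    neg_apply] at h
  linarith

end Adjoint

section Bounded

variable {E : Type*} [NormedAddCommGroup E] [NormedSpace ℝ E] [FiniteDimensional ℝ E]

theorem isVonNBounded_of_pos (B : E →L[ℝ] E →L[ℝ] ℝ) (hB : ∀ u, u ≠ 0 → 0 < B u u) :
    Bornology.IsVonNBounded ℝ {u : E | B u u < 1} := by
  have hc : Continuous fun u ↦ B u u := B.continuous.clm_apply continuous_id
  rcases (Metric.sphere (0 : E) 1).eq_empty_or_nonempty with h | h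
  · have : Subsingleton E := by
      by_contra hE
      rw [not_subsingleton_iff_nontrivial] at hE
      obtain ⟨u, hu⟩ := exists_norm_eq E (zero_le_one (α := ℝ))
      exact (Set.eq_empty_iff_forall_notMem.1 h u) (by simp [hu])
    exact NormedSpace.isVonNBounded_of_isBounded ℝ (Bornology.IsBounded.all _)
  · obtain ⟨u₀, hu₀, hmin⟩ := (isCompact_sphere (0 : E) 1).exists_isMinOn h hc.continuousOn
    have hn : u₀ ≠ 0 := by rintro rfl; simp at hu₀
    have hpos := hB u₀ hn
    refine NormedSpace.isVonNBounded_of_isBounded ℝ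
      ((Metric.isBounded_closedBall (x := (0 : E)) (r := 1 + (B u₀ u₀)⁻¹)).subset ?_)
    intro u hu
    rw [mem_closedBall_zero_iff]
    by_contra! hlt
    have hinv : 0 < (B u₀ u₀)⁻¹ := inv_pos.2 hpos
    have hu0 : 0 < ‖u‖ := by linarith
    have h1 : B u₀ u₀ ≤ B (‖u‖⁻¹ • u) (‖u‖⁻¹ • u) :=
      hmin (by simp [norm_smul, hu0.ne'])
    have h2 : B u₀ u₀ * (‖u‖ * ‖u‖) ≤ B u u := by
      simp only [map_smul, smul_apply, smul_eq_mul] at h1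
      rw [← mul_assoc, ← mul_inv] at h1
      rw [← le_div_iff₀ (by positivity), div_eq_inv_mul]
      exact h1
    have h3 : B u u < 1 := hu
    have h4 : 1 < B u₀ u₀ * ‖u‖ := by
      calc 1 = B u₀ u₀ * (B u₀ u₀)⁻¹ := (mul_inv_cancel₀ hpos.ne').symm
        _ < B u₀ u₀ * ‖u‖ := by gcongr; linarith
    nlinarith

end Bounded

section ContactStructure

variable {E : Type*} [NormedAddCommGroup E] [NormedSpace ℝ E] [FiniteDimensional ℝ E]
  {H : Type*} [TopologicalSpace H] (I : ModelWithCorners ℝ E H)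
  (G : Type*) [TopologicalSpace G] [ChartedSpace H G] [Group G] [LieGroup I ∞ G]

/-- The values at `1` of a left-invariant normal almost contact metric structure for a
bi-invariant metric. -/
structure ContactData where
  /-- The scalar product. -/
  B : E →L[ℝ] E →L[ℝ] ℝ
  /-- The Reeb vector. -/
  ξ : E
  /-- The endomorphism. -/
  φ : E →L[ℝ] E
  symm : ∀ u v, B u v = B v u
  pos : ∀ u, u ≠ 0 → 0 < B u u
  adInv : ∀ (a : G) u v, B (adInv I a u) (SasakiTorsion.adInv I a v) = B u v
  skew_ad : ∀ w u v, B (lieBilin I G w u) v = -B u (lieBilin I G w v)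
  unit : B ξ ξ = 1
  phi_xi : φ ξ = 0
  phi_phi : ∀ u, φ (φ u) = -u + B ξ u • ξ
  phi_skew : ∀ u v, B (φ u) v = -B u (φ v)
  integrable : ∀ u v, lieBilin I G (φ u) (φ v) - lieBilin I G u v -
    φ (lieBilin I G (φ u) v) - φ (lieBilin I G u (φ v)) = 0

namespace ContactData

variable {I G} (D : ContactData I G)

/-- The left-invariant extension of the scalar product. -/
def inner (x : G) : TangentSpace I x →L[ℝ] TangentSpace I x →L[ℝ] ℝ :=
  letI m : E →L[ℝ] E := mcForm I x
  letI d : E →L[ℝ] E →L[ℝ] ℝ := D.B.bilinearComp m m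
  d

theorem inner_apply (x : G) (v w : TangentSpace I x) :
    D.inner x v w = D.B (mcForm I x v) (mcForm I x w) := rfl

/-- The left-invariant Riemannian metric. -/
def metric : ContMDiffRiemannianMetric I ∞ E (fun x : G ↦ TangentSpace I x) where
  inner := D.inner
  symm x v w := D.symm _ _
  pos x v hv := D.pos (mcForm I x v) fun h ↦
    hv (by rw [← leftFrame_mcForm I x v, h, map_zero])
  isVonNBounded x := by
    refine ((isVonNBounded_of_pos D.B D.pos).image (leftFrame I x)).subset ?_
    intro v hv
    exact ⟨mcForm I x v, hv, leftFrame_mcForm I x v⟩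
  contMDiff := by
    intro x
    refine contMDiffAt_hom_of_apply fun s hs ↦ contMDiffAt_hom_of_apply fun t ht ↦ ?_
    rw [contMDiffAt_totalSpace]
    refine ⟨contMDiffAt_id, ?_⟩
    exact (D.B.contMDiff.contMDiffAt.comp x (contMDiffAt_mcForm hs)).clm_apply
      (contMDiffAt_mcForm ht)

/-- The left-invariant almost contact metric structure. -/
def toAlmostContactMetric : AlmostContactMetric I G where
  g := D.metric
  xi x := leftFrame I x D.ξ
  smooth_xi := isSmoothField_leftFrame_const D.ξ
  phi x := (leftFrame I x).comp (D.φ.comp (mcForm I x))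
  smooth_phi := by
    intro x
    refine contMDiffAt_hom_of_apply fun s hs ↦ ?_
    exact contMDiffAt_leftFrame (D.φ.contMDiff.contMDiffAt.comp x (contMDiffAt_mcForm hs))
  unit_xi x := by simp [metric, inner_apply, D.unit]
  phi_xi x := by simp [D.phi_xi]
  phi_phi x v := by simp [D.phi_phi, metric, inner_apply]
  inner_phi_phi x v w := by
    simp only [metric, inner_apply, ContinuousLinearMap.comp_apply,
      mcForm_leftFrame]
    rw [D.phi_skew, D.phi_phi, map_add, map_neg, map_smul, D.symm _ D.ξ, smul_eq_mul]
    ring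

end ContactData

end ContactStructure

section SasakiStructure

variable {E : Type*} [NormedAddCommGroup E] [NormedSpace ℝ E]
  {H : Type*} [TopologicalSpace H] {I : ModelWithCorners ℝ E H}
  {G : Type*} [TopologicalSpace G] [ChartedSpace H G] [Group G] [LieGroup I ∞ G]

theorem IsSmoothField.mdifferentiableAt_leftCoord {X : Π x : G, TangentSpace I x}
    (hX : IsSmoothField I X) (x : G) : MDifferentiableAt I 𝓘(ℝ, E) (SasakiTorsion.leftCoord X) x :=
  mdifferentiableAt_mcForm (hX.mdifferentiableAt x)

theorem mfderiv_mul_left_eq (a x : G) (v : TangentSpace I x) :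
    mfderiv I I (fun y ↦ a * y) x v = leftFrame I (a * x) (mcForm I x v) := by
  rw [← mfderiv_mul_left_leftFrame, leftFrame_mcForm]

theorem mfderiv_mul_right_eq (a x : G) (v : TangentSpace I x) :
    mfderiv I I (fun y ↦ y * a) x v = leftFrame I (x * a) (adInv I a (mcForm I x v)) := by
  rw [← mfderiv_mul_right_leftFrame, leftFrame_mcForm]

variable [FiniteDimensional ℝ E]

theorem IsSmoothField.leftCoord_mlieBracket {X Y : Π x : G, TangentSpace I x}
    (hX : IsSmoothField I X) (hY : IsSmoothField I Y) (x : G) :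
    SasakiTorsion.leftCoord (VectorField.mlieBracket I X Y) x =
      mvfderiv I (SasakiTorsion.leftCoord Y) x (X x) -
        mvfderiv I (SasakiTorsion.leftCoord X) x (Y x) +
        lieBilin I G (SasakiTorsion.leftCoord X x) (SasakiTorsion.leftCoord Y x) :=
  SasakiTorsion.leftCoord_mlieBracket (hX.mdifferentiableAt x) (hY.mdifferentiableAt x)

namespace ContactData

variable (D : ContactData I G)

theorem isLeftInvariant : IsLeftInvariant D.toAlmostContactMetric where
  metric a x v w := by
    have h : ∀ u, mcForm I (a * x) (mfderiv I I (fun y ↦ a * y) x u) = mcForm I x u := fun u ↦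
      (congrArg (mcForm I (a * x)) (mfderiv_mul_left_eq a x u)).trans (mcForm_leftFrame I _ _)
    exact congrArg₂ (fun p q ↦ D.B p q) (h v) (h w)
  reeb a x := mfderiv_mul_left_leftFrame I a x D.ξ
  phi a x v := by
    have h : mcForm I (a * x) (mfderiv I I (fun y ↦ a * y) x v) = mcForm I x v :=
      (congrArg (mcForm I (a * x)) (mfderiv_mul_left_eq a x v)).trans (mcForm_leftFrame I _ _)
    exact (mfderiv_mul_left_leftFrame I a x (D.φ (mcForm I x v))).trans
      (congrArg (fun p ↦ leftFrame I (a * x) (D.φ p)) h.symm)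

theorem isBiInvariant : IsBiInvariant D.toAlmostContactMetric.g where
  left := D.isLeftInvariant.metric
  right a x v w := by
    have h : ∀ u, mcForm I (x * a) (mfderiv I I (fun y ↦ y * a) x u) =
        SasakiTorsion.adInv I a (mcForm I x u) := fun u ↦
      (congrArg (mcForm I (x * a)) (mfderiv_mul_right_eq a x u)).trans (mcForm_leftFrame I _ _)
    exact (congrArg₂ (fun p q ↦ D.B p q) (h v) (h w)).trans (D.adInv a _ _)

theorem metric_eq (X Y : Π x : G, TangentSpace I x) : D.toAlmostContactMetric.metric X Y =
    fun x ↦ D.B (leftCoord X x) (leftCoord Y x) := rfl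

theorem xi_eq (x : G) : D.toAlmostContactMetric.xi x = leftFrame I x D.ξ := rfl

theorem leftCoord_xi : leftCoord D.toAlmostContactMetric.xi = fun _ : G ↦ D.ξ :=
  leftCoord_leftFrame fun _ ↦ D.ξ

theorem eta_eq (X : Π x : G, TangentSpace I x) : D.toAlmostContactMetric.eta X =
    fun x ↦ D.B D.ξ (leftCoord X x) := by
  ext x
  exact congrArg (fun p ↦ D.B p (leftCoord X x)) (mcForm_leftFrame I x D.ξ)

theorem phi_apply (x : G) (v : TangentSpace I x) :
    D.toAlmostContactMetric.phi x v = leftFrame I x (D.φ (mcForm I x v)) := rfl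

theorem leftCoord_phiField (X : Π x : G, TangentSpace I x) :
    leftCoord (D.toAlmostContactMetric.phiField X) = fun x ↦ D.φ (leftCoord X x) :=
  leftCoord_leftFrame fun x ↦ D.φ (leftCoord X x)

theorem fundForm_eq (X Y : Π x : G, TangentSpace I x) : D.toAlmostContactMetric.fundForm X Y =
    fun x ↦ D.B (D.φ (leftCoord X x)) (leftCoord Y x) := by
  ext x
  exact congrArg (fun p ↦ D.B p (leftCoord Y x)) (mcForm_leftFrame I x _)

theorem isSmoothField_phiField {X : Π x : G, TangentSpace I x} (hX : IsSmoothField I X) :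
    IsSmoothField I (D.toAlmostContactMetric.phiField X) :=
  isSmoothField_leftFrame (D.φ.contMDiff.comp hX.leftCoord)

theorem inner_xi_phi (u : E) : D.B D.ξ (D.φ u) = 0 := by
  rw [D.symm, D.phi_skew, D.phi_xi, map_zero, neg_zero]

theorem inner_phi_phi (u v : E) : D.B (D.φ u) (D.φ v) = D.B u v - D.B D.ξ u * D.B D.ξ v := by
  rw [D.phi_skew, D.phi_phi, map_add, map_neg, map_smul, D.symm u D.ξ, smul_eq_mul]
  ring

theorem inner_lie_cyclic (u v w : E) :
    D.B (lieBilin I G u v) w = D.B (lieBilin I G v w) u := by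
  rw [D.symm (lieBilin I G v w), lieBilin_skew u v, map_neg, neg_apply, D.skew_ad]
  ring

theorem inner_lie_swap (u v w : E) :
    D.B (lieBilin I G u v) w = -D.B (lieBilin I G v u) w := by
  rw [lieBilin_skew u v, map_neg, neg_apply]

theorem extDerivOne_eta {X Y : Π x : G, TangentSpace I x} (hX : IsSmoothField I X)
    (hY : IsSmoothField I Y) (x : G) : extDerivOne I D.toAlmostContactMetric.eta X Y x =
      -D.B D.ξ (lieBilin I G (leftCoord X x) (leftCoord Y x)) := by
  simp only [extDerivOne, eta_eq, lieDerivFun]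
  rw [mvfderiv_clm_apply (D.B D.ξ) (hX.mdifferentiableAt_leftCoord x),
    mvfderiv_clm_apply (D.B D.ξ) (hY.mdifferentiableAt_leftCoord x),
    hX.leftCoord_mlieBracket hY, map_add, map_sub]
  ring

theorem isNormal : D.toAlmostContactMetric.IsNormal := by
  intro X Y hX hY x
  have hX' := D.isSmoothField_phiField hX
  have hY' := D.isSmoothField_phiField hY
  have key : ∀ v : TangentSpace I x, mcForm I x v = 0 → v = 0 := fun v hv ↦ by
    rw [← leftFrame_mcForm I x v, hv, map_zero]
  apply key
  rw [extDerivOne_eta D hX hY, xi_eq]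
  simp only [phi_apply, map_add, map_sub, mcForm_leftFrame, map_smul]
  have e1 := hX'.leftCoord_mlieBracket hY' x
  have e2 := hX.leftCoord_mlieBracket hY x
  have e3 := hX'.leftCoord_mlieBracket hY x
  have e4 := hX.leftCoord_mlieBracket hY' x
  simp only [leftCoord_phiField] at e1 e3 e4
  rw [mvfderiv_clm_apply D.φ (hY.mdifferentiableAt_leftCoord x),
    mvfderiv_clm_apply D.φ (hX.mdifferentiableAt_leftCoord x)] at e1
  rw [mvfderiv_clm_apply D.φ (hX.mdifferentiableAt_leftCoord x)] at e3
  rw [mvfderiv_clm_apply D.φ (hY.mdifferentiableAt_leftCoord x)] at e4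
  have hN := D.integrable (leftCoord X x) (leftCoord Y x)
  have hP := D.phi_phi (lieBilin I G (leftCoord X x) (leftCoord Y x))
  change leftCoord _ x + D.φ (D.φ (leftCoord _ x)) - D.φ (leftCoord _ x) - D.φ (leftCoord _ x)
    + _ = 0
  rw [e1, e2, e3, e4]
  simp only [map_add, map_sub]
  rw [hP]
  rw [← hN]
  module

theorem isKilling : D.toAlmostContactMetric.IsKilling := by
  intro X Y hX hY x
  have hξ : IsSmoothField I D.toAlmostContactMetric.xi := D.toAlmostContactMetric.smooth_xi
  simp only [metric_eq, lieDerivFun]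
  rw [mvfderiv_bilin_apply D.B (hX.mdifferentiableAt_leftCoord x)
    (hY.mdifferentiableAt_leftCoord x), hξ.leftCoord_mlieBracket hX, hξ.leftCoord_mlieBracket hY,
    leftCoord_xi]
  have h0 : ∀ v, mvfderiv I (fun _ : G ↦ D.ξ) x v = 0 := fun v ↦ by
    rw [mvfderiv_const]; rfl
  simp only [h0, sub_zero, map_add, add_apply, D.skew_ad]
  ring

theorem extDerivTwo_fundForm {X Y Z : Π x : G, TangentSpace I x} (hX : IsSmoothField I X)
    (hY : IsSmoothField I Y) (hZ : IsSmoothField I Z) (x : G) :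
    extDerivTwo I D.toAlmostContactMetric.fundForm X Y Z x =
      -D.B (D.φ (lieBilin I G (leftCoord X x) (leftCoord Y x))) (leftCoord Z x) +
      D.B (D.φ (lieBilin I G (leftCoord X x) (leftCoord Z x))) (leftCoord Y x) -
      D.B (D.φ (lieBilin I G (leftCoord Y x) (leftCoord Z x))) (leftCoord X x) := by
  have hd : ∀ {U V W : Π x : G, TangentSpace I x}, IsSmoothField I U → IsSmoothField I V →
      mvfderiv I (fun y ↦ D.B (D.φ (leftCoord U y)) (leftCoord V y)) x (W x) =
      D.B (D.φ (mvfderiv I (leftCoord U) x (W x))) (leftCoord V x) -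
      D.B (D.φ (mvfderiv I (leftCoord V) x (W x))) (leftCoord U x) := by
    intro U V W hU hV
    refine (mvfderiv_bilin_apply (D.B.comp D.φ) (hU.mdifferentiableAt_leftCoord x)
      (hV.mdifferentiableAt_leftCoord x) (W x)).trans ?_
    simp only [ContinuousLinearMap.comp_apply]
    rw [D.phi_skew (leftCoord U x), D.symm (leftCoord U x)]
    ring
  simp only [extDerivTwo, fundForm_eq, lieDerivFun]
  rw [hd hY hZ, hd hX hZ, hd hX hY, hX.leftCoord_mlieBracket hY, hX.leftCoord_mlieBracket hZ,
    hY.leftCoord_mlieBracket hZ]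
  simp only [map_add, map_sub, add_apply, sub_apply]
  ring

/-- The torsion form is `-g([X, Y], Z)`, with the bracket taken in the Lie algebra. -/
theorem torsionForm_eq {X Y Z : Π x : G, TangentSpace I x} (hX : IsSmoothField I X)
    (hY : IsSmoothField I Y) (hZ : IsSmoothField I Z) :
    D.toAlmostContactMetric.torsionForm X Y Z = fun x ↦
      -D.B (lieBilin I G (leftCoord X x) (leftCoord Y x)) (leftCoord Z x) := by
  ext x
  rw [AlmostContactMetric.torsionForm, extDerivOne_eta D hY hZ, extDerivOne_eta D hZ hX,
    extDerivOne_eta D hX hY, extDerivTwo_fundForm D (D.isSmoothField_phiField hX)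
    (D.isSmoothField_phiField hY) (D.isSmoothField_phiField hZ)]
  simp only [eta_eq, leftCoord_phiField, inner_phi_phi]
  generalize leftCoord X x = f
  generalize leftCoord Y x = g
  generalize leftCoord Z x = h
  have hη : ∀ u v, D.B D.ξ (lieBilin I G (D.φ u) (D.φ v)) = D.B D.ξ (lieBilin I G u v) := by
    intro u v
    have := congrArg (D.B D.ξ) (D.integrable u v)
    simp only [map_sub, inner_xi_phi, sub_zero, map_zero] at this
    linarith
  have hN := congrArg (fun u ↦ D.B u h) (D.integrable f g)
  simp only [map_sub, sub_apply, map_zero, zero_apply, D.phi_skew (lieBilin I G _ _)] at hN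
  have h1 : D.B (lieBilin I G (D.φ f) (D.φ h)) g = -D.B (lieBilin I G (D.φ f) g) (D.φ h) := by
    rw [inner_lie_cyclic, inner_lie_cyclic, inner_lie_swap]
  have h2 : D.B (lieBilin I G (D.φ g) (D.φ h)) f = D.B (lieBilin I G f (D.φ g)) (D.φ h) :=
    (inner_lie_cyclic D _ _ _).symm
  have h3 : D.B D.ξ (lieBilin I G h f) = -D.B D.ξ (lieBilin I G f h) := by
    rw [lieBilin_skew, map_neg]
  rw [hη, hη, hη, h1, h2, h3]
  linarith

theorem isST : D.toAlmostContactMetric.IsST := ⟨D.isNormal, D.isKilling⟩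

theorem mvfderiv_torsion {X Y Z : Π x : G, TangentSpace I x} (hX : IsSmoothField I X)
    (hY : IsSmoothField I Y) (hZ : IsSmoothField I Z) (x : G) (v : TangentSpace I x) :
    mvfderiv I (D.toAlmostContactMetric.torsionForm X Y Z) x v =
      -D.B (lieBilin I G (mvfderiv I (leftCoord X) x v) (leftCoord Y x)) (leftCoord Z x) +
      D.B (lieBilin I G (mvfderiv I (leftCoord Y) x v) (leftCoord X x)) (leftCoord Z x) -
      D.B (lieBilin I G (mvfderiv I (leftCoord Z) x v) (leftCoord X x)) (leftCoord Y x) := by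
  have hdX := hX.mdifferentiableAt_leftCoord x
  have hdY := hY.mdifferentiableAt_leftCoord x
  have hdZ := hZ.mdifferentiableAt_leftCoord x
  simp only [torsionForm_eq D hX hY hZ, ← inner_lie_swap]
  rw [mvfderiv_bilin_apply D.B (mdifferentiableAt_bilin_apply (lieBilin I G) hdY hdX) hdZ v,
    mvfderiv_bilin_apply _ hdY hdX]
  simp only [map_add, add_apply]
  rw [inner_lie_cyclic D (leftCoord Y x) (leftCoord X x), inner_lie_swap D (leftCoord X x)]
  ring

theorem isSST : D.toAlmostContactMetric.IsSST where
  toIsST := D.isST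
  closed X Y Z W hX hY hZ hW x := by
    simp only [extDerivThree, lieDerivFun]
    rw [mvfderiv_torsion D hY hZ hW, mvfderiv_torsion D hX hZ hW, mvfderiv_torsion D hX hY hW,
      mvfderiv_torsion D hX hY hZ, torsionForm_eq D (hX.mlieBracket hY) hZ hW,
      torsionForm_eq D (hX.mlieBracket hZ) hY hW, torsionForm_eq D (hX.mlieBracket hW) hY hZ,
      torsionForm_eq D (hY.mlieBracket hZ) hX hW, torsionForm_eq D (hY.mlieBracket hW) hX hZ,
      torsionForm_eq D (hZ.mlieBracket hW) hX hY]
    simp only [hX.leftCoord_mlieBracket hY, hX.leftCoord_mlieBracket hZ,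
      hX.leftCoord_mlieBracket hW, hY.leftCoord_mlieBracket hZ, hY.leftCoord_mlieBracket hW,
      hZ.leftCoord_mlieBracket hW, map_add, map_sub, add_apply, sub_apply]
    generalize leftCoord X x = f
    generalize leftCoord Y x = g
    generalize leftCoord Z x = h
    generalize leftCoord W x = k
    have hQ : ∀ a b c d : E, D.B (lieBilin I G (lieBilin I G a b) c) d =
        D.B (lieBilin I G a b) (lieBilin I G c d) := by
      intro a b c d
      rw [inner_lie_swap, D.skew_ad, neg_neg]
    have hf : ∀ a v : E, D.B (lieBilin I G f a) v = D.B f (lieBilin I G a v) := by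
      intro a v
      rw [inner_lie_swap, D.skew_ad, neg_neg]
    have hJ := congrArg (D.B f) (lieBilin_jacobi (I := I) (G := G) g h k)
    rw [lieBilin_skew (lieBilin I G g h) k, map_add, map_neg] at hJ
    rw [hQ f g h k, hQ f h g k, hQ f k g h, hQ g h f k, hQ g k f h, hQ h k f g,
      D.symm (lieBilin I G g h), D.symm (lieBilin I G g k), D.symm (lieBilin I G h k),
      hf g, hf h, hf k]
    linear_combination 2 * hJ

end ContactData

end SasakiStructure

section Canonical

variable {E : Type*} [NormedAddCommGroup E] [NormedSpace ℝ E]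
  {H : Type*} [TopologicalSpace H] (I : ModelWithCorners ℝ E H)
  (G : Type*) [TopologicalSpace G] [ChartedSpace H G] [Group G] [LieGroup I ∞ G]

/-- The canonical connection, for which the left-invariant vector fields are parallel. -/
def canonicalConnection : CovariantDerivative I E (fun x : G ↦ TangentSpace I x) where
  toFun Y x := (leftFrame I x).comp (mvfderiv I (leftCoord Y) x)
  isCovariantDerivativeOnUniv :=
    { add := fun {σ σ' x} hσ hσ' _ ↦ by
        have h : leftCoord (σ + σ') = leftCoord σ + leftCoord σ' := by
          ext y; exact map_add (mcForm I y) _ _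
        rw [h, mvfderiv_add (g := leftCoord σ) (g' := leftCoord σ') (mdifferentiableAt_mcForm hσ) (mdifferentiableAt_mcForm hσ'),
          ContinuousLinearMap.comp_add]
      leibniz := fun {σ g x} hσ hg _ ↦ by
        have h : leftCoord (g • σ) = g • leftCoord σ := by
          ext y; exact map_smul (mcForm I y) _ _
        ext v
        rw [h, ContinuousLinearMap.comp_apply, mvfderiv_smul hg (g := leftCoord σ) (mdifferentiableAt_mcForm hσ)]
        simp only [add_apply, smul_apply, ContinuousLinearMap.smulRight_apply, map_add, map_smul,
          ContinuousLinearMap.comp_apply]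
        rw [leftCoord, leftFrame_mcForm] }

variable {I G}

theorem canonicalConnection_apply (Y : Π x : G, TangentSpace I x) (x : G) (v : TangentSpace I x) :
    canonicalConnection I G Y x v = leftFrame I x (mvfderiv I (leftCoord Y) x v) := rfl

theorem canonicalConnection_leftFrame (v : E) (x : G) :
    canonicalConnection I G (fun y ↦ leftFrame I y v) x = 0 := by
  ext w
  rw [canonicalConnection_apply, leftCoord_leftFrame fun _ ↦ v, mvfderiv_const]
  exact map_zero (leftFrame I x)

variable [FiniteDimensional ℝ E]

theorem isSmoothField_canonicalConnection {X Y : Π x : G, TangentSpace I x}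
    (hX : IsSmoothField I X) (hY : IsSmoothField I Y) :
    IsSmoothField I (fun x ↦ canonicalConnection I G Y x (X x)) := by
  let b := Module.finBasis ℝ E
  have h : (fun x ↦ canonicalConnection I G Y x (X x)) = mlieBracket I X Y - ∑ i,
      (fun x ↦ (b.coord i).toContinuousLinearMap (leftCoord Y x)) •
        mlieBracket I X (fun y ↦ leftFrame I y (b i)) := by
    ext x
    rw [Pi.sub_apply, mlieBracket_eq_sum X (hY.mdifferentiableAt x), Finset.sum_apply]
    exact (add_sub_cancel_right _ _).symm
  rw [h]
  intro x
  refine ContMDiffAt.sub_section ((hX.mlieBracket hY) x) ?_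
  have hs : ContMDiffAt I I.tangent ∞ (fun x ↦ (⟨x, ∑ i,
      ((fun x ↦ (b.coord i).toContinuousLinearMap (leftCoord Y x)) •
        mlieBracket I X (fun y ↦ leftFrame I y (b i))) x⟩ : TangentBundle I G)) x := by
    refine ContMDiffAt.sum_section fun i _ ↦ ContMDiffAt.smul_section ?_
      ((hX.mlieBracket (isSmoothField_leftFrame_const (b i))) x)
    exact (ContinuousLinearMap.contMDiff _).contMDiffAt.comp x (hY.leftCoord x)
  simpa only [Finset.sum_apply] using hs

theorem canonicalConnection_flat {X Y Z : Π x : G, TangentSpace I x} (hX : IsSmoothField I X)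
    (hY : IsSmoothField I Y) (hZ : IsSmoothField I Z) (x : G) :
    canonicalConnection I G (fun y ↦ canonicalConnection I G Z y (Y y)) x (X x) -
      canonicalConnection I G (fun y ↦ canonicalConnection I G Z y (X y)) x (Y x) -
      canonicalConnection I G Z x (mlieBracket I X Y x) = 0 := by
  have hd : ∀ {U : Π x : G, TangentSpace I x}, IsSmoothField I U →
      MDifferentiableAt I 𝓘(ℝ, E) (fun y ↦ mvfderiv I (leftCoord Z) y (U y)) x := by
    intro U hU
    have h := (isSmoothField_canonicalConnection hU hZ).mdifferentiableAt_leftCoord x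
    simp only [canonicalConnection_apply] at h
    rwa [leftCoord_leftFrame fun y ↦ mvfderiv I (leftCoord Z) y (U y)] at h
  simp only [canonicalConnection_apply]
  rw [leftCoord_leftFrame fun y ↦ mvfderiv I (leftCoord Z) y (Y y),
    leftCoord_leftFrame fun y ↦ mvfderiv I (leftCoord Z) y (X y), ← map_sub, ← map_sub]
  refine (congrArg (leftFrame I x) ?_).trans (map_zero _)
  rcases subsingleton_or_nontrivial E with hE | hE
  · exact Subsingleton.elim _ _
  obtain ⟨e, he⟩ := exists_ne (0 : E)
  refine (Module.finBasis ℝ E).ext_elem fun i ↦ ?_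
  let c : E →L[ℝ] ℝ := ((Module.finBasis ℝ E).coord i).toContinuousLinearMap
  have hdZ : ∀ y, MDifferentiableAt I 𝓘(ℝ, E) (leftCoord Z) y := hZ.mdifferentiableAt_leftCoord
  have hfun : ∀ U : Π x : G, TangentSpace I x,
      (fun y ↦ mvfderiv I (fun z ↦ c (leftCoord Z z)) y (U y)) =
        fun y ↦ c (mvfderiv I (leftCoord Z) y (U y)) := by
    intro U; ext y
    exact mvfderiv_clm_apply c (hdZ y) _
  have key := mvfderiv_commutator (W := fun y ↦ leftFrame I y e) hX hY
    (isSmoothField_leftFrame_const e) (c.contMDiff.comp hZ.leftCoord) x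
    (fun h ↦ he (by rw [← mcForm_leftFrame I x e, h, map_zero]))
    (by
      have := mdifferentiableAt_clm_apply c (hd hX)
      rwa [← hfun] at this)
    (by
      have := mdifferentiableAt_clm_apply c (hd hY)
      rwa [← hfun] at this)
  have key' : mvfderiv I (fun y ↦ mvfderiv I (fun z ↦ c (leftCoord Z z)) y (Y y)) x (X x) -
      mvfderiv I (fun y ↦ mvfderiv I (fun z ↦ c (leftCoord Z z)) y (X y)) x (Y x) =
      mvfderiv I (fun z ↦ c (leftCoord Z z)) x (mlieBracket I X Y x) := key
  rw [hfun, hfun, mvfderiv_clm_apply c (hd hY), mvfderiv_clm_apply c (hd hX),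
    mvfderiv_clm_apply c (hdZ x)] at key'
  have h0 : c (mvfderiv I (fun y ↦ mvfderiv I (leftCoord Z) y (Y y)) x (X x) -
      mvfderiv I (fun y ↦ mvfderiv I (leftCoord Z) y (X y)) x (Y x) -
      mvfderiv I (leftCoord Z) x (mlieBracket I X Y x)) = c 0 := by
    rw [map_sub, map_sub, key', sub_self, map_zero]
  exact h0

/-- A connection for which the left-invariant vector fields are parallel is the canonical one. -/
theorem eq_canonicalConnection (nabla : CovariantDerivative I E (fun x : G ↦ TangentSpace I x))
    {x : G} (h : ∀ v : E, nabla (fun y ↦ leftFrame I y v) x = 0) {Y : Π x : G, TangentSpace I x}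
    (hY : MDifferentiableAt I I.tangent (fun y ↦ (⟨y, Y y⟩ : TangentBundle I G)) x) :
    nabla Y x = canonicalConnection I G Y x := by
  have i1 : IsManifold I 1 G := IsManifold.of_le (n := ∞) ENat.LEInfty.out
  let τ : Π y : G, TangentSpace I y := fun y ↦ leftFrame I y (leftCoord Y x)
  have h1 := IsCovariantDerivativeOn.difference_apply nabla.isCovariantDerivativeOnUniv
    (canonicalConnection I G).isCovariantDerivativeOnUniv (x := x) trivial hY
  have h2 := IsCovariantDerivativeOn.difference_apply nabla.isCovariantDerivativeOnUniv
    (canonicalConnection I G).isCovariantDerivativeOnUniv (x := x) trivial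
    ((isSmoothField_leftFrame_const (leftCoord Y x)).mdifferentiableAt x)
  have h3 : leftFrame I x (leftCoord Y x) = Y x := congrFun (leftFrame_leftCoord Y) x
  rw [h3, h1] at h2
  have h4 : (canonicalConnection I G).toFun τ x = 0 := canonicalConnection_leftFrame _ x
  have h5 : nabla.toFun τ x = 0 := h _
  exact sub_eq_zero.1 (h2.trans (by rw [h4, h5, sub_zero]))

end Canonical

namespace ContactData

variable {E : Type*} [NormedAddCommGroup E] [NormedSpace ℝ E] [FiniteDimensional ℝ E]
  {H : Type*} [TopologicalSpace H] {I : ModelWithCorners ℝ E H}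
  {G : Type*} [TopologicalSpace G] [ChartedSpace H G] [Group G] [LieGroup I ∞ G]
  (D : ContactData I G)

theorem metric_inner (x : G) (v w : TangentSpace I x) :
    D.toAlmostContactMetric.g.inner x v w = D.B (mcForm I x v) (mcForm I x w) := rfl

/-- The torsion of the canonical connection. -/
theorem inner_torsion {X Y Z : Π x : G, TangentSpace I x} (hX : IsSmoothField I X)
    (hY : IsSmoothField I Y) (hZ : IsSmoothField I Z) (x : G) :
    D.toAlmostContactMetric.g.inner x (canonicalConnection I G Y x (X x) -
      canonicalConnection I G X x (Y x) - mlieBracket I X Y x) (Z x) =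
      D.toAlmostContactMetric.torsionForm X Y Z x := by
  rw [torsionForm_eq D hX hY hZ, metric_inner, canonicalConnection_apply, canonicalConnection_apply,
    map_sub (mcForm I x), map_sub (mcForm I x), mcForm_leftFrame, mcForm_leftFrame]
  change D.B (_ - _ - leftCoord (mlieBracket I X Y) x) (leftCoord Z x) = _
  rw [hX.leftCoord_mlieBracket hY, sub_add_cancel_left, map_neg, neg_apply]

theorem isSTConnection : D.toAlmostContactMetric.IsSTConnection (canonicalConnection I G) where
  smooth _ _ hX hY := isSmoothField_canonicalConnection hX hY
  metric X Y Z hX hY hZ x := by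
    rw [metric_eq, lieDerivFun, mvfderiv_bilin_apply D.B (hY.mdifferentiableAt_leftCoord x)
      (hZ.mdifferentiableAt_leftCoord x), metric_inner, metric_inner, canonicalConnection_apply,
      canonicalConnection_apply, mcForm_leftFrame, mcForm_leftFrame]
    rfl
  reeb x := canonicalConnection_leftFrame D.ξ x
  phi X Y hX hY x := by
    rw [phi_apply, canonicalConnection_apply, canonicalConnection_apply, leftCoord_phiField,
      mcForm_leftFrame, mvfderiv_clm_apply D.φ (hY.mdifferentiableAt_leftCoord x)]
  skew X Y Z hX hY hZ x := by
    rw [inner_torsion D hX hY hZ, inner_torsion D hX hZ hY, torsionForm_eq D hX hY hZ,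
      torsionForm_eq D hX hZ hY, neg_neg, inner_lie_cyclic, inner_lie_cyclic, inner_lie_swap]

theorem isSTConnection_unique (nabla : CovariantDerivative I E (fun x : G ↦ TangentSpace I x))
    (h : D.toAlmostContactMetric.IsSTConnection nabla) {Y : Π x : G, TangentSpace I x}
    (hY : IsSmoothField I Y) : nabla Y = canonicalConnection I G Y := by
  ext1 x
  refine eq_canonicalConnection nabla (fun v ↦ ?_) (hY.mdifferentiableAt x)
  let Γ : E → E → E := fun u v ↦ mcForm I x (nabla (fun y ↦ leftFrame I y v) x (leftFrame I x u))
  let A : E → E → E → ℝ := fun u v w ↦ D.B (Γ u v) w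
  have hs : ∀ v : E, IsSmoothField I (fun y : G ↦ leftFrame I y v) := isSmoothField_leftFrame_const
  have hΓ : ∀ u v, nabla (fun y ↦ leftFrame I y v) x (leftFrame I x u) = leftFrame I x (Γ u v) :=
    fun u v ↦ (leftFrame_mcForm I x _).symm
  have h23 : ∀ u v w, A u v w = -A u w v := by
    intro u v w
    have h1 := h.metric _ _ _ (hs u) (hs v) (hs w) x
    rw [metric_eq, leftCoord_leftFrame fun _ ↦ v, leftCoord_leftFrame fun _ ↦ w, lieDerivFun,
      mvfderiv_const, hΓ, hΓ, metric_inner, metric_inner] at h1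
    simp only [mcForm_leftFrame, zero_apply] at h1
    rw [D.symm v] at h1
    exact eq_neg_of_add_eq_zero_left h1.symm
  have h13 : ∀ u v w, A u v w = -A w v u := by
    intro u v w
    have h1 := h.skew _ _ _ (hs v) (hs u) (hs w) x
    simp only [mlieBracket_leftFrame_const, hΓ, metric_inner, map_sub, mcForm_leftFrame,
      sub_apply] at h1
    have h2 := D.inner_lie_cyclic v w u
    have h3 := D.inner_lie_cyclic w u v
    have h4 := D.inner_lie_swap u v w
    have e1 : D.B (Γ v u) w = -D.B (Γ v w) u := h23 v u w
    have e2 : D.B (Γ w v) u = -D.B (Γ w u) v := h23 w v u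
    change D.B (Γ u v) w = -D.B (Γ w v) u
    have e3 := D.inner_lie_swap v u w
    have e4 := D.inner_lie_swap v w u
    linarith
  have hφ : ∀ u v w, A u (D.φ v) w = -A u v (D.φ w) := by
    intro u v w
    have h1 := h.phi _ _ (hs u) (hs v) x
    have h2 : D.toAlmostContactMetric.phiField (fun y : G ↦ leftFrame I y v) =
        fun y ↦ leftFrame I y (D.φ v) := by
      ext y
      change leftFrame I y (D.φ (mcForm I y (leftFrame I y v))) = _
      rw [mcForm_leftFrame]
    rw [h2, phi_apply, hΓ, hΓ, mcForm_leftFrame] at h1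
    have h3 : Γ u (D.φ v) = D.φ (Γ u v) := by
      rw [← mcForm_leftFrame I x (Γ u (D.φ v)), h1, mcForm_leftFrame]
    change D.B (Γ u (D.φ v)) w = -D.B (Γ u v) (D.φ w)
    rw [h3, D.phi_skew]
  have hξ : ∀ u w, A u D.ξ w = 0 := by
    intro u w
    have h1 : Γ u D.ξ = 0 := by
      change mcForm I x (nabla D.toAlmostContactMetric.xi x _) = 0
      rw [h.reeb x]
      exact map_zero _
    change D.B (Γ u D.ξ) w = 0
    rw [h1, map_zero, zero_apply]
  have hφ0 : ∀ u v w, A u v (D.φ w) = 0 := by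
    intro u v w
    have e1 := hφ u v w
    have e2 := hφ w u v
    have e3 := hφ v w u
    have s1 := h13 u (D.φ v) w
    have s2 := h23 w (D.φ v) u
    have s3 := h13 w (D.φ u) v
    have s4 := h23 v (D.φ u) w
    have s5 := h13 v (D.φ w) u
    have s6 := h23 u (D.φ w) v
    linarith
  have hA : ∀ u v w, A u v w = 0 := by
    intro u v w
    have h1 := hφ0 u v (D.φ w)
    rw [D.phi_phi] at h1
    change D.B (Γ u v) _ = 0 at h1
    rw [map_add, map_neg, map_smul] at h1
    have h2 : D.B (Γ u v) D.ξ = 0 := by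
      have := h23 u v D.ξ
      rw [hξ, neg_zero] at this
      exact this
    rw [h2, smul_zero, add_zero, neg_eq_zero] at h1
    exact h1
  have hΓ0 : ∀ u, Γ u v = 0 := by
    intro u
    by_contra hne
    exact (D.pos _ hne).ne' (hA u v (Γ u v))
  ext w
  have h1 := hΓ (mcForm I x w) v
  rw [leftFrame_mcForm, hΓ0, map_zero] at h1
  exact h1

end ContactData
end SasakiTorsion

end

theorem mainTheorem1
    {E : Type*} [NormedAddCommGroup E] [NormedSpace ℝ E] [FiniteDimensional ℝ E]
    {H : Type*} [TopologicalSpace H] (I : ModelWithCorners ℝ E H) [I.Boundaryless]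
    {G : Type*} [TopologicalSpace G] [ChartedSpace H G] [Group G] [LieGroup I ∞ G]
    [T2Space G] [CompactSpace G] [ConnectedSpace G]
    (hodd : Odd (Module.finrank ℝ E)) :
    ∃ S : SasakiTorsion.AlmostContactMetric I G,
      -- it is a left-invariant strong Sasaki with torsion structure
      S.IsSST ∧ SasakiTorsion.IsLeftInvariant S ∧
      -- the metric is bi-invariant
      SasakiTorsion.IsBiInvariant S.g ∧
      -- the endomorphism preserves a Cartan subalgebra containing the Reeb vector, and it is
      -- `i` on the positive root spaces and `-i` on the negative ones
      (∃ (t : LieSubalgebra ℝ (GroupLieAlgebra I G)) (P : Set (t →ₗ[ℝ] ℂ)),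
        t.IsCartanSubalgebra ∧ SasakiTorsion.IsPositiveSystem t P ∧
        S.xi 1 ∈ t ∧ (∀ h ∈ t, S.phi 1 h ∈ t) ∧
        (∀ α ∈ P, ∀ Z ∈ SasakiTorsion.rootSpace t α,
          LinearMap.baseChange ℂ (S.phi 1 : GroupLieAlgebra I G →ₗ[ℝ] GroupLieAlgebra I G) Z =
            Complex.I • Z) ∧
        (∀ α ∈ P, ∀ Z ∈ SasakiTorsion.rootSpace t (-α),
          LinearMap.baseChange ℂ (S.phi 1 : GroupLieAlgebra I G →ₗ[ℝ] GroupLieAlgebra I G) Z =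
            -Complex.I • Z)) ∧
      -- the torsion form is `-g([X, Y], Z)` on left-invariant fields
      (∀ (u v w : GroupLieAlgebra I G) (x : G),
        S.torsionForm (mulInvariantVectorField u) (mulInvariantVectorField v)
          (mulInvariantVectorField w) x = -S.g.inner 1 ⁅u, v⁆ w) ∧
      -- the flat canonical connection, for which left-invariant fields are parallel, is an almost
      -- contact metric connection with skew torsion, its torsion is `c`, and it is the only one
      ∃ nabla : CovariantDerivative I E (fun x : G ↦ TangentSpace I x),
        (∀ u : GroupLieAlgebra I G, ∀ x : G, nabla (mulInvariantVectorField u) x = 0) ∧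
        (∀ X Y Z : Π x : G, TangentSpace I x, SasakiTorsion.IsSmoothField I X →
          SasakiTorsion.IsSmoothField I Y → SasakiTorsion.IsSmoothField I Z → ∀ x : G,
          nabla (fun y ↦ nabla Z y (Y y)) x (X x) - nabla (fun y ↦ nabla Z y (X y)) x (Y x)
            - nabla Z x (VectorField.mlieBracket I X Y x) = 0) ∧
        S.IsSTConnection nabla ∧
        (∀ X Y Z : Π x : G, TangentSpace I x, SasakiTorsion.IsSmoothField I X →
          SasakiTorsion.IsSmoothField I Y → SasakiTorsion.IsSmoothField I Z → ∀ x : G,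
          S.g.inner x (nabla Y x (X x) - nabla X x (Y x) - VectorField.mlieBracket I X Y x) (Z x) =
            S.torsionForm X Y Z x) ∧
        (∀ nabla' : CovariantDerivative I E (fun x : G ↦ TangentSpace I x),
          S.IsSTConnection nabla' → ∀ Y : Π x : G, TangentSpace I x,
            SasakiTorsion.IsSmoothField I Y → nabla' Y = nabla Y) := by
  have : IsTopologicalGroup G := topologicalGroup_of_lieGroup I ∞
  obtain ⟨B, hsymm, hpos, hinv⟩ := SasakiTorsion.exists_invariant_scalarProduct
    (SasakiTorsion.adInv I : G → E →L[ℝ] E) (fun u ↦ (SasakiTorsion.contMDiff_adInv I u).continuous)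
    (SasakiTorsion.adInv_mul I) (SasakiTorsion.adInv_one I)
  have hskew := SasakiTorsion.lieBilin_skew_of_adInv I B hinv
  let B₀ : GroupLieAlgebra I G →ₗ[ℝ] GroupLieAlgebra I G →ₗ[ℝ] ℝ :=
    ContinuousLinearMap.coeLM ℝ ∘ₗ (B : E →ₗ[ℝ] E →L[ℝ] ℝ)
  have hfd : FiniteDimensional ℝ (GroupLieAlgebra I G) := inferInstanceAs (FiniteDimensional ℝ E)
  obtain ⟨ξ, φ, h1, h2, h3, h4, h5, t, P, ht, hP, hξ, hφ, hr, hr'⟩ :=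
    SasakiTorsion.exists_lie_structure (L := GroupLieAlgebra I G) B₀ hodd hsymm hpos
      (fun x y z ↦ by
        have h : B (SasakiTorsion.lieBilin I G x y) z = -B y (SasakiTorsion.lieBilin I G x z) :=
          hskew x y z
        exact h)
  let φ' : E →ₗ[ℝ] E := φ
  let D : SasakiTorsion.ContactData I G :=
    { B := B
      ξ := ξ
      φ := LinearMap.toContinuousLinearMap φ'
      symm := hsymm
      pos := hpos
      adInv := hinv
      skew_ad := hskew
      unit := h1
      phi_xi := h2
      phi_phi := h3
      phi_skew := h4
      integrable := h5 }
  let S := D.toAlmostContactMetric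
  have hxi : S.xi 1 = ξ := SasakiTorsion.leftFrame_one I ξ
  have hphi1 : ∀ v : E, SasakiTorsion.leftFrame I (1 : G)
      (φ' (SasakiTorsion.mcForm I (1 : G) v)) = φ' v := fun v ↦
    (SasakiTorsion.leftFrame_one I _).trans (congrArg φ' (SasakiTorsion.mcForm_one I v))
  have hphi : (S.phi 1 : GroupLieAlgebra I G →ₗ[ℝ] GroupLieAlgebra I G) = φ :=
    LinearMap.ext hphi1
  refine ⟨S, D.isSST, D.isLeftInvariant, D.isBiInvariant, ⟨t, P, ht, hP, ?_, ?_, ?_, ?_⟩, ?_,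
    SasakiTorsion.canonicalConnection I G, SasakiTorsion.canonicalConnection_leftFrame (E := E),
    fun X Y Z hX hY hZ ↦ SasakiTorsion.canonicalConnection_flat hX hY hZ, D.isSTConnection,
    fun X Y Z hX hY hZ ↦ D.inner_torsion hX hY hZ,
    fun nabla h Y hY ↦ D.isSTConnection_unique nabla h hY⟩
  · rw [hxi]; exact hξ
  · intro h hh
    have h1 : S.phi 1 h = φ h := hphi1 h
    rw [h1]; exact hφ h hh
  · rw [hphi]; exact hr
  · rw [hphi]; exact hr'
  · intro u v w x
    have hs : ∀ v : GroupLieAlgebra I G,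
        SasakiTorsion.IsSmoothField I (mulInvariantVectorField v : Π y : G, TangentSpace I y) :=
      SasakiTorsion.isSmoothField_leftFrame_const (E := E)
    have hl : ∀ v : E, SasakiTorsion.leftCoord (fun y : G ↦ SasakiTorsion.leftFrame I y v) x = v :=
      SasakiTorsion.mcForm_leftFrame I x
    refine (congrFun (D.torsionForm_eq (hs u) (hs v) (hs w)) x).trans (congrArg Neg.neg ?_)
    exact congrArg₂ (fun p q ↦ B p q)
      ((congrArg₂ (fun p q ↦ SasakiTorsion.lieBilin I G p q) (hl u) (hl v)).trans
        (SasakiTorsion.mcForm_one (E := E) I _).symm)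
      ((hl w).trans (SasakiTorsion.mcForm_one (E := E) I w).symm)
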